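/- Theorem 4.3. All C*-algebras are complex, all actions of groups on C*-algebras are by *-automorphisms, and an action of $G$ is non-degenerate if no nontrivial element of $G$ acts as the identity. Definitions. (1) An inclusion $B\subset\widetilde B$ of unital C*-algebras with a non-degenerate action of a finite group $G$ on $\widetilde B$ such that $B=\widetilde B^G$ is a unital noncommutative finite-fold covering $(B,\widetilde B,G)$ if $\widetilde B$, with the $B$-valued product $\langle a,b\rangle=\sum_{g\in G}g(a^*b)$, is a finitely generated projective Hilbert $B$-module. (2) Let $A\subset\widetilde A$ be C*-algebras, with an action of $G$ on $\widetilde A$. The triple $(A,\widetilde A,G)$ is a noncommutative finite-fold covering with compactification if there are a unital noncommutative finite-fold covering $(B,\widetilde B,G)$ and inclusions $A\subset B$, $\widetilde A\subset\widetilde B$, compatible with $A\subset\widetilde A$ and $B\subset\widetilde B$, such that $A$ is an essential ideal of $B$, $\widetilde A$ is an essential ideal of $\widetilde B$, $A=B\cap\widetilde A$, $G\widetilde A=\widetilde A$, and the action of $G$ on $\widetilde B$ restricts to the given action on $\widetilde A$. (3) Let $A\to\widetilde A$ be an injective *-homomorphism of C*-algebras and let a finite group $G$ act non-degenerately on $\widetilde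 A$. The triple $(A,\widetilde A,G)$ is a noncommutative finite-fold covering if $A$ is identified with $\widetilde A^G$ and there is a family $\{\widetilde I_\lambda\}$ of closed two-sided ideals of $\widetilde A$ with $G\widetilde I_\lambda=\widetilde I_\lambda$ such that $\bigcup_\lambda\widetilde I_\lambda$ is dense in $\widetilde A$, $\bigcup_\lambda(A\cap\widetilde I_\lambda)$ is dense in $A$, and each $(A\cap\widetilde I_\lambda,\widetilde I_\lambda,G)$, with the restricted action, is a noncommutative finite-fold covering with compactification. (4) A continuous surjection $\pi:\widetilde{\mathcal X}\to\mathcal X$ is a finite-fold regular covering if it is a covering with finite fibres and, for every closed path $\omega$ in $\mathcal X$, either every lift of $\omega$ to $\widetilde{\mathcal X}$ is closed or none is. $G(\widetilde{\mathcal X}\,|\,\mathcal X)$ denotes the group of homeomorphisms $g$ of $\widetilde{\mathcal X}$ with $\pi\circ g=\pi$. Statement. Let $\mathcal X,\widetilde{\mathcal X}$ be locally compact Hausdorff spaces and $\pi:\widetilde{\mathcal X}\to\mathcal X$ a surjective continuous map. Below, $C_0(\mathcal X)\to C_0(\widetilde{\mathcal X})$ is the map $f\mapsto f\circ\pi$ (its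 taking values in $C_0(\widetilde{\mathcal X})$ is part of each assertion that mentions it). (A) If $(C_0(\mathcal X),C_0(\widetilde{\mathcal X}),G)$ is a noncommutative finite-fold covering for some group $G$ with some action on $C_0(\widetilde{\mathcal X})$, then $\pi$ is a finite-fold regular covering. (B) If $\mathcal X$ is connected and locally path-connected, the following are equivalent: (i) $\pi$ is a finite-fold regular covering; (ii) $(C_0(\mathcal X),C_0(\widetilde{\mathcal X}),G)$ is a noncommutative finite-fold covering for some group $G$ with some action on $C_0(\widetilde{\mathcal X})$; (iii) $(C_0(\mathcal X),C_0(\widetilde{\mathcal X}),G)$ is a noncommutative finite-fold covering for $G=G(\widetilde{\mathcal X}\,|\,\mathcal X)$ with its natural action $(gf)(\tilde x)=f(g^{-1}\tilde x)$. -/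

import Mathlib

open scoped ZeroAtInfty

namespace NCCovering

/-! ### Finite-fold coverings of C*-algebras

An involutive action of a group `G` on a C*-algebra `A'` is a homomorphism `G →* (A' ≃⋆ₐ[ℂ] A')`
to the group of *-automorphisms; it is non-degenerate if and only if this homomorphism is
injective. An inclusion `A ⊂ A'` is an injective *-homomorphism `ι : A → A'`. -/

/-- The C*-algebra `B'`, regarded as a right module over `B` along `i : B → B'`. -/
def RightModule {B B' : Type*} [CStarAlgebra B] [CStarAlgebra B'] (_i : B →⋆ₐ[ℂ] B') : Type _ := B'

noncomputable instance {B B' : Type*} [CStarAlgebra B] [CStarAlgebra B'] (i : B →⋆ₐ[ℂ] B') :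
    AddCommGroup (RightModule i) :=
  inferInstanceAs (AddCommGroup B')

/-- The right action of `B` on `B'` is `x · b = x * i b`. -/
noncomputable instance {B B' : Type*} [CStarAlgebra B] [CStarAlgebra B'] (i : B →⋆ₐ[ℂ] B') :
    Module Bᵐᵒᵖ (RightModule i) :=
  Module.compHom B' (RingHom.op (i : B →+* B'))

theorem RightModule.op_smul_def {B B' : Type*} [CStarAlgebra B] [CStarAlgebra B']
    (i : B →⋆ₐ[ℂ] B') (b : B) (x : B') :
    (MulOpposite.op b • (show RightModule i from x)) = (x * i b : B') := rfl

/-- `(B, B', G)` is a unital noncommutative finite-fold covering: `G` is a finite group acting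
non-degenerately on `B'`, `B` is identified by `i` with the fixed point algebra, and `B'` is a
finitely generated projective `B`-module. (The `B`-valued product
`⟨x, y⟩ = ∑ g, g (x* y)` makes `B'` a Hilbert `B`-module automatically: the norm it defines is
equivalent to the C*-norm because `x* x ≤ ⟨x, x⟩ ≤ |G| ‖x‖²`.) -/
structure IsUnitalFiniteFoldCovering {B B' G : Type*} [CStarAlgebra B] [CStarAlgebra B'] [Group G]
    (i : B →⋆ₐ[ℂ] B') (β : G →* (B' ≃⋆ₐ[ℂ] B')) : Prop where
  finite_group : Finite G
  injective : Function.Injective i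
  nondegenerate : Function.Injective β
  fixedPoints : Set.range i = {b : B' | ∀ g : G, β g b = b}
  finite : Module.Finite Bᵐᵒᵖ (RightModule i)
  projective : Module.Projective Bᵐᵒᵖ (RightModule i)

/-- The image of the *-homomorphism `j : A → B` is an essential ideal of `B`: a two-sided ideal
(closed, as an image of a *-homomorphism of C*-algebras) whose annihilator is zero. -/
structure HasEssentialIdealRange {A B : Type*} [NonUnitalCStarAlgebra A] [CStarAlgebra B]
    (j : A →⋆ₙₐ[ℂ] B) : Prop where
  mul_mem_left : ∀ (b : B) (a : A), b * j a ∈ Set.range j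
  mul_mem_right : ∀ (b : B) (a : A), j a * b ∈ Set.range j
  essential : ∀ b : B, (∀ a : A, b * j a = 0) → b = 0

universe u v

/-- `(A, A', G)` is a noncommutative finite-fold covering with compactification: there are
a unital noncommutative finite-fold covering `(B, B', G)` and inclusions `j : A → B`,
`j' : A' → B'` as essential ideals, compatible with `A ⊂ A'` and `B ⊂ B'`, such that
`A = B ∩ A'` inside `B'` and `A'` is invariant under `G`, the action of `G` on `A'` being the
restriction of the action on `B'`. -/
def IsFiniteFoldCoveringWithCompactification {A : Type u} {A' : Type v} {G : Type*}
    [NonUnitalCStarAlgebra A] [NonUnitalCStarAlgebra A'] [Group G]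
    (ι : A →⋆ₙₐ[ℂ] A') (α : G →* (A' ≃⋆ₐ[ℂ] A')) : Prop :=
  ∃ (B : Type u) (B' : Type v) (_ : CStarAlgebra B) (_ : CStarAlgebra B')
    (i : B →⋆ₐ[ℂ] B') (β : G →* (B' ≃⋆ₐ[ℂ] B')) (j : A →⋆ₙₐ[ℂ] B) (j' : A' →⋆ₙₐ[ℂ] B'),
    Function.Injective ι ∧ Function.Injective j ∧ Function.Injective j' ∧
    (∀ a : A, i (j a) = j' (ι a)) ∧
    HasEssentialIdealRange j ∧ HasEssentialIdealRange j' ∧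
    Set.range (fun a : A => i (j a)) = Set.range i ∩ Set.range j' ∧
    IsUnitalFiniteFoldCovering i β ∧
    ∀ (g : G) (a : A'), β g (j' a) = j' (α g a)

/-- Closed two-sided ideals of a C*-algebra (they are automatically *-invariant complex
subspaces). -/
structure ClosedIdeal (A : Type*) [NonUnitalCStarAlgebra A] extends
    NonUnitalStarSubalgebra ℂ A where
  ideal_left : ∀ (a : A), ∀ x ∈ carrier, a * x ∈ carrier
  ideal_right : ∀ (a : A), ∀ x ∈ carrier, x * a ∈ carrier
  isClosed : IsClosed carrier

instance {A : Type*} [NonUnitalCStarAlgebra A] (J : ClosedIdeal A) :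
    IsClosed (J.toNonUnitalStarSubalgebra : Set A) := J.isClosed

/-- The intersection `A ∩ J` of a closed ideal `J` of `A'` with `A`, where `A` is embedded in `A'`
by `ι`. -/
def ClosedIdeal.comap {A A' : Type*} [NonUnitalCStarAlgebra A] [NonUnitalCStarAlgebra A']
    (ι : A →⋆ₙₐ[ℂ] A') (J : ClosedIdeal A') : ClosedIdeal A where
  toNonUnitalStarSubalgebra := J.toNonUnitalStarSubalgebra.comap ι
  ideal_left a x hx := by
    change ι (a * x) ∈ J.carrier
    rw [map_mul]
    exact J.ideal_left (ι a) (ι x) hx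
  ideal_right a x hx := by
    change ι (x * a) ∈ J.carrier
    rw [map_mul]
    exact J.ideal_right (ι a) (ι x) hx
  isClosed := J.isClosed.preimage
    (AddMonoidHomClass.continuous_of_bound ι 1
      (by simpa only [one_mul] using! NonUnitalStarAlgHom.norm_apply_le ι))

/-- The inclusion `A ∩ J → J`. -/
def ClosedIdeal.inclusion {A A' : Type*} [NonUnitalCStarAlgebra A] [NonUnitalCStarAlgebra A']
    (ι : A →⋆ₙₐ[ℂ] A') (J : ClosedIdeal A') :
    (J.comap ι).toNonUnitalStarSubalgebra →⋆ₙₐ[ℂ] J.toNonUnitalStarSubalgebra :=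
  NonUnitalStarAlgHom.codRestrict
    (ι.comp (NonUnitalStarSubalgebraClass.subtype (J.comap ι).toNonUnitalStarSubalgebra))
    J.toNonUnitalStarSubalgebra (fun x => x.2)

/-- The restriction of an action of `G` to an invariant closed ideal. -/
def ClosedIdeal.restrictAction {A G : Type*} [NonUnitalCStarAlgebra A] [Group G]
    (α : G →* (A ≃⋆ₐ[ℂ] A)) (J : ClosedIdeal A)
    (hJ : ∀ g : G, α g '' J.carrier = J.carrier) :
    G →* (J.toNonUnitalStarSubalgebra ≃⋆ₐ[ℂ] J.toNonUnitalStarSubalgebra) where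
  toFun g :=
    { toFun := fun x => ⟨α g x, (hJ g).subset ⟨x, x.2, rfl⟩⟩
      invFun := fun x => ⟨α g⁻¹ x, (hJ g⁻¹).subset ⟨x, x.2, rfl⟩⟩
      left_inv := fun x => Subtype.ext (by
        change α g⁻¹ (α g x) = x
        rw [← StarAlgEquiv.mul_apply, ← map_mul]; simp)
      right_inv := fun x => Subtype.ext (by
        change α g (α g⁻¹ x) = x
        rw [← StarAlgEquiv.mul_apply, ← map_mul]; simp)
      map_mul' := fun x y => Subtype.ext (map_mul (α g) (x : A) y)
      map_add' := fun x y => Subtype.ext (map_add (α g) (x : A) y)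
      map_star' := fun x => Subtype.ext (map_star (α g) (x : A))
      map_smul' := fun c x => Subtype.ext (map_smul (α g) c (x : A)) }
  map_one' := by ext x; simp
  map_mul' g h := by ext x; simp

/-- `(A, A', G)` is a noncommutative finite-fold covering: `G` is a finite group acting
non-degenerately on `A'`, `A` is identified by `ι` with the fixed point algebra, and there is
a family of `G`-invariant closed ideals `J` of `A'` such that the union of the `J` is dense in
`A'`, the union of the `A ∩ J` is dense in `A`, and every `(A ∩ J, J, G)` is a noncommutative
finite-fold covering with compactification. -/
structure IsFiniteFoldCovering {A A' G : Type*}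
    [NonUnitalCStarAlgebra A] [NonUnitalCStarAlgebra A'] [Group G]
    (ι : A →⋆ₙₐ[ℂ] A') (α : G →* (A' ≃⋆ₐ[ℂ] A')) : Prop where
  finite_group : Finite G
  injective : Function.Injective ι
  nondegenerate : Function.Injective α
  fixedPoints : Set.range ι = {a : A' | ∀ g : G, α g a = a}
  exists_ideals : ∃ F : Set (ClosedIdeal A'),
    Dense (⋃ J ∈ F, J.carrier) ∧
    Dense (⋃ J ∈ F, (J.comap ι).carrier) ∧
    ∀ J ∈ F, ∃ hJ : ∀ g : G, α g '' J.carrier = J.carrier,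
      IsFiniteFoldCoveringWithCompactification (J.inclusion ι) (J.restrictAction α hJ)

/-! ### Coverings of topological spaces -/

/-- A map is regular if, given any closed path in the base, either every lifting of it is closed
or none is closed. -/
def IsRegular {X X' : Type*} [TopologicalSpace X] [TopologicalSpace X'] (π : X' → X) : Prop :=
  ∀ ω : C(unitInterval, X), ω 0 = ω 1 →
    (∀ ω' : C(unitInterval, X'), (∀ t, π (ω' t) = ω t) → ω' 0 = ω' 1) ∨
    (∀ ω' : C(unitInterval, X'), (∀ t, π (ω' t) = ω t) → ω' 0 ≠ ω' 1)

/-- Finite-fold regular coverings: regular covering maps with finite fibres. -/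
structure IsFiniteFoldRegularCovering {X X' : Type*} [TopologicalSpace X] [TopologicalSpace X']
    (π : X' → X) : Prop where
  isCoveringMap : IsCoveringMap π
  finite_fiber : ∀ x : X, (π ⁻¹' {x}).Finite
  regular : IsRegular π

/-- The group of covering transformations of `π`. -/
def deckGroup {X X' : Type*} [TopologicalSpace X'] (π : X' → X) : Subgroup (X' ≃ₜ X') where
  carrier := {f | ∀ x, π (f x) = π x}
  mul_mem' {f g} hf hg x := by
    change π (f (g x)) = π x
    rw [hf, hg]
  one_mem' _ := rfl
  inv_mem' {f} hf x := by
    have h : π (f (f.symm x)) = π (f.symm x) := hf (f.symm x)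
    rw [f.apply_symm_apply] at h
    exact h.symm

/-- The action `(g f)(x) = f (g⁻¹ x)` of the group of homeomorphisms of `X` on `C₀(X)`. -/
noncomputable def homeoAction (X : Type*) [TopologicalSpace X] :
    (X ≃ₜ X) →* (C₀(X, ℂ) ≃⋆ₐ[ℂ] C₀(X, ℂ)) where
  toFun g :=
    { toFun := fun f => f.comp g.symm.toCocompactMap
      invFun := fun f => f.comp g.toCocompactMap
      left_inv := fun f => by ext x; simp
      right_inv := fun f => by ext x; simp
      map_mul' := fun _ _ => rfl
      map_add' := fun _ _ => rfl
      map_star' := fun _ => rfl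
      map_smul' := fun _ _ => rfl }
  map_one' := rfl
  map_mul' _ _ := rfl

/-- The natural action of the group of covering transformations of `π : X' → X` on `C₀(X')`. -/
noncomputable def deckAction {X X' : Type*} [TopologicalSpace X'] (π : X' → X) :
    deckGroup π →* (C₀(X', ℂ) ≃⋆ₐ[ℂ] C₀(X', ℂ)) :=
  (homeoAction X').comp (deckGroup π).subtype

/-- `(C₀(X), C₀(X'), G)` is a noncommutative finite-fold covering with respect to the natural
map `f ↦ f ∘ π` (in particular this map takes `C₀(X)` to `C₀(X')`). -/
def IsNaturalFiniteFoldCovering {X X' G : Type*} [TopologicalSpace X] [TopologicalSpace X']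
    [Group G] (π : X' → X) (α : G →* (C₀(X', ℂ) ≃⋆ₐ[ℂ] C₀(X', ℂ))) : Prop :=
  ∃ ι : C₀(X, ℂ) →⋆ₙₐ[ℂ] C₀(X', ℂ), (∀ f x, ι f x = f (π x)) ∧ IsFiniteFoldCovering ι α

end NCCovering

/-! ### Covering transformations of regular coverings -/

namespace NCCovering

open Topology unitInterval

/-! By Gelfand duality (`homeoAction_bijective`) an action of `G` on `C₀(X')` is an action on `X'`.
If `C₀(X)` is the algebra of invariants, then `π` is open and its fibres are the orbits
(`isOpenMap_of_fixedPoints`, `apply_eq_apply_iff_of_fixedPoints`). As `G` is finite, `π` is also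
closed with finite fibres, so it is a covering once it is locally injective; it is then regular,
because two lifts of one path are translates of each other.

Local injectivity at `y` follows if the stabilizer `H` of `y` fixes all points near `y`, and this is
where finite generation enters. The operator `f ↦ ∑ h, (f - f ∘ h⁻¹)` is linear over the invariants,
so its values, up to a cutoff, are combinations of finitely many functions `v k`, which have zero
`H`-average and hence vanish at `y`. A Nakayama-type argument (`eventually_fixed_of_generators`)
divides them by an invariant function `t` of the order of the square root of their common size: the
quotients `w k` still have zero average, so they are combinations of the `v l = t * w l`. Since `t`
tends to `0` at `y`, all of them vanish near `y`; there every function is `H`-invariant and `H` acts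
trivially. The algebra `B'` of a compactification need not be commutative; multiplication by an
invariant element of the ideal turns its generators into functions (`exists_generators`).

Conversely, over a connected, locally path-connected base the covering transformations form a finite
group, transitive on fibres (`IsFiniteFoldRegularCovering.exists_deckGroup_apply_eq`) and faithful
on each of them (`eq_of_eqOn_fiber`). For `U` open and relatively compact, the functions vanishing
off `π ⁻¹' U` are compactified by the continuous functions on the preimage of `closure U`, where
bump functions supported in sets of injectivity of `π` give a dual basis
(`isUnitalFiniteFoldCovering_of_orbits`). Such ideals have dense union. -/

theorem _root_.IsLocalHomeomorph.locallyPathConnectedSpace {X X' : Type*} [TopologicalSpace X]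
    [TopologicalSpace X'] [LocallyPathConnectedSpace X] {π : X' → X} (hπ : IsLocalHomeomorph π) :
    LocallyPathConnectedSpace X' := by
  rw [locallyPathConnectedSpace_iff_pathComponentIn_mem_nhds]
  intro x u hu hxu
  obtain ⟨φ, hx, -⟩ := hπ x
  have hS : IsOpen (φ '' (φ.source ∩ u)) :=
    φ.isOpen_image_of_subset_source (φ.open_source.inter hu) Set.inter_subset_left
  have hmem : φ x ∈ φ '' (φ.source ∩ u) := ⟨x, ⟨hx, hxu⟩, rfl⟩
  set P := pathComponentIn (φ '' (φ.source ∩ u)) (φ x)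
  have hP : P ⊆ φ '' (φ.source ∩ u) := pathComponentIn_subset
  have hPt : P ⊆ φ.target := by
    intro z hz
    obtain ⟨w, hw, rfl⟩ := hP hz
    exact φ.map_source hw.1
  have hopen : IsOpen (φ.symm '' P) := φ.isOpen_symm_image_iff_of_subset_target hPt |>.2
    (hS.pathComponentIn _)
  have hxP : x ∈ φ.symm '' P :=
    ⟨φ x, mem_pathComponentIn_self hmem, φ.left_inv hx⟩
  refine Filter.mem_of_superset (hopen.mem_nhds hxP) ?_
  have hpc : IsPathConnected (φ.symm '' P) :=
    (isPathConnected_pathComponentIn hmem).image' (φ.continuousOn_symm.mono hPt)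
  refine hpc.subset_pathComponentIn hxP ?_
  rintro _ ⟨z, hz, rfl⟩
  obtain ⟨w, hw, rfl⟩ := hP hz
  rw [φ.left_inv hw.1]
  exact hw.2

section Lift

variable {X X' : Type*} [TopologicalSpace X] [TopologicalSpace X'] {π : X' → X}

/-- In a regular covering, lifts with a common starting point of paths with common end points
have a common end point, as soon as one pair of lifts has. -/
theorem IsFiniteFoldRegularCovering.lift_apply_one_eq (h : IsFiniteFoldRegularCovering π)
    {y y' : X'} (γ γ' Γ Γ' : C(I, X')) (h0 : γ 0 = y) (h0' : γ' 0 = y)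
    (H0 : Γ 0 = y') (H0' : Γ' 0 = y') (hΓ : π ∘ Γ = π ∘ γ) (hΓ' : π ∘ Γ' = π ∘ γ')
    (h1 : γ 1 = γ' 1) : Γ 1 = Γ' 1 := by
  have hc := h.isCoveringMap
  let p : Path y (γ 1) := ⟨γ, h0, rfl⟩
  let p' : Path y (γ 1) := ⟨γ', h0', h1.symm⟩
  obtain ⟨δ, hδ, hδ0⟩ := hc.exists_path_lifts
    ((⟨π, hc.continuous⟩ : C(X', X)).comp (p'.symm : C(I, X'))) (Γ 1) (by
      have := congr_fun hΓ 1
      simp only [Function.comp_apply] at this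
      simp [this])
  let P : Path y' (Γ 1) := ⟨Γ, H0, rfl⟩
  let Q : Path (Γ 1) (δ 1) := ⟨δ, hδ0, rfl⟩
  have key : ∀ t, π (P.trans Q t) = π (p.trans p'.symm t) := by
    intro t
    simp only [Path.trans_apply]
    split_ifs with ht
    · exact congr_fun hΓ _
    · exact congr_fun hδ _
  -- The loop `p · p'⁻¹` is a closed lift of its own projection, so regularity makes the lift `P ·
  -- Q` starting at `y'` closed too. Then `Q` reversed lifts the same path as `Γ'` from the same
  -- point.
  have hreg := h.regular ((⟨π, hc.continuous⟩ : C(X', X)).comp (p.trans p'.symm : C(I, X'))) (by simp)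
  have hclosed : δ 1 = y' := by
    rcases hreg with hr | hr
    · have := hr (P.trans Q : C(I, X')) key
      simpa using this.symm
    · exact absurd (by simp) (hr (p.trans p'.symm : C(I, X')) (fun t => rfl))
  have hΓδ : (Γ' : I → X') = Q.symm := by
    refine hc.eq_of_comp_eq Γ'.continuous Q.symm.continuous ?_ 0 ?_
    · rw [hΓ']
      funext t
      have := congr_fun hδ (σ t)
      simp only [Function.comp_apply, ContinuousMap.comp_apply, ContinuousMap.coe_mk] at this
      simp only [Function.comp_apply, Path.symm_apply]
      change _ = π (δ (σ t))
      rw [this]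
      simp [p']
    · rw [H0', Path.source, hclosed]
  rw [hΓδ]
  simp

/-- In a regular covering of a locally path-connected space, the projection of the path component
of `y` lifts to a map which takes `y` to any other point of its fibre. -/
theorem IsFiniteFoldRegularCovering.exists_lift_pathComponent [LocallyPathConnectedSpace X]
    (h : IsFiniteFoldRegularCovering π) {y y' : X'} (hy : π y = π y') :
    ∃ F : C(pathComponent y, X'), F ⟨y, mem_pathComponent_self y⟩ = y' ∧
      ∀ z, π (F z) = π z := by
  have hc := h.isCoveringMap
  have := hc.isLocalHomeomorph.locallyPathConnectedSpace
  have : LocallyPathConnectedSpace (pathComponent y) :=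
    (IsOpen.pathComponent y).locallyPathConnectedSpace
  have : PathConnectedSpace (pathComponent y) :=
    isPathConnected_iff_pathConnectedSpace.1 isPathConnected_pathComponent
  obtain ⟨F, ⟨hF0, hF⟩, -⟩ := hc.isLocalHomeomorph.existsUnique_continuousMap_lifts
    (⟨fun z => π z, hc.continuous.comp continuous_subtype_val⟩ : C(pathComponent y, X))
    ⟨y, mem_pathComponent_self y⟩ y' hy.symm
    (fun γ hγ => by
      obtain ⟨Γ, h1, h2⟩ := hc.exists_path_lifts
        ((⟨fun z => π z, hc.continuous.comp continuous_subtype_val⟩ : C(pathComponent y, X)).comp γ)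
        y' (by simp [hγ, hy])
      exact ⟨Γ, h2, h1⟩)
    (fun γ γ' Γ Γ' h0 h0' H0 H0' hΓ hΓ' h1 =>
      h.lift_apply_one_eq ((⟨_, continuous_subtype_val⟩ : C(pathComponent y, X')).comp γ)
        ((⟨_, continuous_subtype_val⟩ : C(pathComponent y, X')).comp γ') Γ Γ'
        (y := y) (by simp [h0]) (by simp [h0']) H0 H0' hΓ hΓ' (by simp [h1]))
  exact ⟨F, hF0, fun z => congr_fun hF z⟩

open Classical in
/-- The map which is `F` on the path component of `y`, `F'` on that of `y'` and the identity
elsewhere. -/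
noncomputable def swapComponents {y y' : X'} (F : C(pathComponent y, X'))
    (F' : C(pathComponent y', X')) (z : X') : X' :=
  if hz : z ∈ pathComponent y then F ⟨z, hz⟩
  else if hz : z ∈ pathComponent y' then F' ⟨z, hz⟩ else z

/-- Path components of a locally path-connected space are open and closed, so continuity can be
checked on each of the three pieces. -/
theorem continuous_swapComponents [LocallyPathConnectedSpace X'] {y y' : X'}
    (F : C(pathComponent y, X')) (F' : C(pathComponent y', X')) :
    Continuous (swapComponents F F') := by
  rw [continuous_iff_continuousAt]
  intro z
  by_cases hz : z ∈ pathComponent y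
  · have hn := (IsOpen.pathComponent y).mem_nhds hz
    have : ContinuousOn (swapComponents F F') (pathComponent y) := by
      rw [continuousOn_iff_continuous_domRestrict]
      convert F.continuous using 1
      funext w
      simp [Set.domRestrict, swapComponents, w.2]
    exact this.continuousAt hn
  · have hn := (IsClosed.pathComponent y).isOpen_compl.mem_nhds hz
    by_cases hz' : z ∈ pathComponent y'
    · have hn' := Filter.inter_mem hn ((IsOpen.pathComponent y').mem_nhds hz')
      have : ContinuousOn (swapComponents F F') ((pathComponent y)ᶜ ∩ pathComponent y') := by
        rw [continuousOn_iff_continuous_domRestrict]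
        convert F'.continuous.comp (continuous_inclusion (Set.inter_subset_right
          (s := (pathComponent y)ᶜ))) using 1
        funext w
        have h1 : (w : X') ∉ pathComponent y := w.2.1
        have h2 : (w : X') ∈ pathComponent y' := w.2.2
        simp [Set.domRestrict, swapComponents, h1, h2, Set.inclusion]
      exact this.continuousAt hn'
    · have hn' := Filter.inter_mem hn ((IsClosed.pathComponent y').isOpen_compl.mem_nhds hz')
      refine continuousAt_id.congr ?_
      filter_upwards [hn'] with w hw
      have h1 : (w : X') ∉ pathComponent y := hw.1
      have h2 : (w : X') ∉ pathComponent y' := hw.2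
      simp [swapComponents, h1, h2]

/-- `F' ∘ F` and the inclusion of the path component are lifts of the same map and agree at `y`;
lifts from a connected space are determined by one value. -/
theorem IsFiniteFoldRegularCovering.lift_comp_lift (h : IsFiniteFoldRegularCovering π) {y y' : X'}
    {F : C(pathComponent y, X')} {F' : C(pathComponent y', X')}
    (hF0 : F ⟨y, mem_pathComponent_self y⟩ = y') (hF : ∀ z, π (F z) = π z)
    (hF0' : F' ⟨y', mem_pathComponent_self y'⟩ = y) (hF' : ∀ z, π (F' z) = π z)
    (z : X') (hz : z ∈ pathComponent y) :
    ∃ hz' : F ⟨z, hz⟩ ∈ pathComponent y', F' ⟨F ⟨z, hz⟩, hz'⟩ = z := by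
  have hpc : PathConnectedSpace (pathComponent y) :=
    isPathConnected_iff_pathConnectedSpace.1 isPathConnected_pathComponent
  have hmem : ∀ w, F w ∈ pathComponent y' := by
    intro w
    have hj := (hpc.joined ⟨y, mem_pathComponent_self y⟩ w).map F.continuous
    rw [hF0] at hj
    exact hj
  refine ⟨hmem _, ?_⟩
  have := h.isCoveringMap.eq_of_comp_eq (A := pathComponent y)
    (g₁ := fun w => F' ⟨F w, hmem w⟩) (g₂ := Subtype.val)
    (F'.continuous.comp (F.continuous.subtype_mk hmem)) continuous_subtype_val
    (by funext w; simp [hF, hF']) ⟨y, mem_pathComponent_self y⟩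
    (by simp only [hF0]; exact hF0')
  exact congr_fun this ⟨z, hz⟩

/-- The outer swap tests the component of `y'` first. This makes it undo `F` by `F'` even when the
two components coincide. -/
theorem IsFiniteFoldRegularCovering.swapComponents_swapComponents
    (h : IsFiniteFoldRegularCovering π) {y y' : X'}
    {F : C(pathComponent y, X')} {F' : C(pathComponent y', X')}
    (hF0 : F ⟨y, mem_pathComponent_self y⟩ = y') (hF : ∀ z, π (F z) = π z)
    (hF0' : F' ⟨y', mem_pathComponent_self y'⟩ = y) (hF' : ∀ z, π (F' z) = π z) (z : X') :
    swapComponents F' F (swapComponents F F' z) = z := by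
  by_cases hz : z ∈ pathComponent y
  · obtain ⟨h1, h2⟩ := h.lift_comp_lift hF0 hF hF0' hF' z hz
    simp [swapComponents, hz, h1, h2]
  by_cases hz' : z ∈ pathComponent y'
  · obtain ⟨h1, h2⟩ := h.lift_comp_lift hF0' hF' hF0 hF z hz'
    have h3 : F' ⟨z, hz'⟩ ∉ pathComponent y' := by
      intro hc
      exact hz ((h1.trans hc.symm).trans hz')
    simp [swapComponents, hz, hz', h1, h2, h3]
  · simp [swapComponents, hz, hz']

/-- The group of covering transformations of a regular covering of a locally path-connected
space is transitive on fibres. -/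
theorem IsFiniteFoldRegularCovering.exists_deckGroup_apply_eq [LocallyPathConnectedSpace X]
    (h : IsFiniteFoldRegularCovering π) {y y' : X'} (hy : π y = π y') :
    ∃ g ∈ deckGroup π, g y = y' := by
  have := h.isCoveringMap.isLocalHomeomorph.locallyPathConnectedSpace
  obtain ⟨F, hF0, hF⟩ := h.exists_lift_pathComponent hy
  obtain ⟨F', hF0', hF'⟩ := h.exists_lift_pathComponent hy.symm
  refine ⟨⟨⟨swapComponents F F', swapComponents F' F,
    h.swapComponents_swapComponents hF0 hF hF0' hF',
    h.swapComponents_swapComponents hF0' hF' hF0 hF⟩,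
    continuous_swapComponents F F', continuous_swapComponents F' F⟩, fun z => ?_, ?_⟩
  · change π (swapComponents F F' z) = π z
    unfold swapComponents
    split_ifs
    exacts [hF _, hF' _, rfl]
  · change swapComponents F F' y = y'
    simp [swapComponents, hF0]

/-- A covering transformation over a path-connected space is determined by its restriction to
one fibre. -/
theorem eq_of_eqOn_fiber [PathConnectedSpace X] (hc : IsCoveringMap π) {g g' : X' ≃ₜ X'}
    (hg : g ∈ deckGroup π) (hg' : g' ∈ deckGroup π) (x : X) (hx : ∀ y, π y = x → g y = g' y) :
    g = g' := by
  ext z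
  let p : Path (π z) x := PathConnectedSpace.somePath _ _
  obtain ⟨Γ, hΓ, hΓ0⟩ := hc.exists_path_lifts (p : C(I, X)) z (by simp)
  have h1 : π (Γ 1) = x := by simpa using congr_fun hΓ 1
  have := hc.eq_of_comp_eq (g.continuous.comp Γ.continuous) (g'.continuous.comp Γ.continuous)
    (by funext t; simp only [Function.comp_apply]; rw [hg, hg']) 1 (hx _ h1)
  simpa [hΓ0] using congr_fun this 0

/-- Restriction to one finite fibre embeds the group in the self-maps of that fibre. -/
theorem IsFiniteFoldRegularCovering.finite_deckGroup [PathConnectedSpace X]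
    (h : IsFiniteFoldRegularCovering π) : Finite (deckGroup π) := by
  obtain ⟨x⟩ := (inferInstance : Nonempty X)
  have : Finite (π ⁻¹' {x}) := h.finite_fiber x
  let Φ : deckGroup π → (π ⁻¹' {x} → π ⁻¹' {x}) := fun g y => ⟨g.1 y, by
    have := g.2 y
    simp [this, y.2.out]⟩
  refine Finite.of_injective Φ fun g g' hgg' => Subtype.ext ?_
  refine eq_of_eqOn_fiber h.isCoveringMap g.2 g'.2 x fun y hy => ?_
  exact congr_arg Subtype.val (congr_fun hgg' ⟨y, hy⟩)

end Lift

end NCCovering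

/-! ### Functions vanishing at infinity: bump functions, characters, automorphisms -/

namespace NCCovering

open Topology Filter

section ZeroAtInfty

variable {Y : Type*} [TopologicalSpace Y]

theorem norm_apply_le (f : C₀(Y, ℂ)) (y : Y) : ‖f y‖ ≤ ‖f‖ :=
  f.toBCF.norm_coe_le_norm y

theorem norm_le_iff {f : C₀(Y, ℂ)} {C : ℝ} (hC : 0 ≤ C) : ‖f‖ ≤ C ↔ ∀ y, ‖f y‖ ≤ C :=
  BoundedContinuousFunction.norm_le (f := f.toBCF) hC

theorem exists_isCompact_norm_lt (f : C₀(Y, ℂ)) {ε : ℝ} (hε : 0 < ε) :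
    ∃ K : Set Y, IsCompact K ∧ ∀ y ∉ K, ‖f y‖ < ε := by
  have h := (zero_at_infty f).eventually (Metric.ball_mem_nhds (0 : ℂ) hε)
  obtain ⟨K, hK, hKf⟩ := mem_cocompact.1 h
  exact ⟨K, hK, fun y hy => by simpa using hKf hy⟩

/-- The element of `C₀(Y)` given by a continuous function which is small off compact sets. -/
def ofTendsto (f : Y → ℂ) (hf : Continuous f)
    (h : ∀ ε > 0, ∃ K : Set Y, IsCompact K ∧ ∀ y ∉ K, ‖f y‖ < ε) : C₀(Y, ℂ) where
  toFun := f
  continuous_toFun := hf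
  zero_at_infty' := by
    rw [Metric.tendsto_nhds]
    intro ε hε
    obtain ⟨K, hK, hKf⟩ := h ε hε
    exact mem_cocompact.2 ⟨K, hK, fun y hy => by simpa using hKf y hy⟩

theorem exists_eq_of_dominated (f : Y → ℂ) (hf : Continuous f) (g : C₀(Y, ℂ)) (C : ℝ)
    (h : ∀ y, ‖f y‖ ≤ C * ‖g y‖) : ∃ F : C₀(Y, ℂ), ∀ y, F y = f y := by
  refine ⟨ofTendsto f hf fun ε hε => ?_, fun _ => rfl⟩
  obtain ⟨K, hK, hKg⟩ := exists_isCompact_norm_lt g (ε := ε / (|C| + 1)) (by positivity)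
  refine ⟨K, hK, fun y hy => (h y).trans_lt ?_⟩
  have h1 := hKg y hy
  rw [lt_div_iff₀ (by positivity)] at h1
  nlinarith [le_abs_self C, norm_nonneg (g y)]

theorem exists_eq_of_isCompact (f : Y → ℂ) (hf : Continuous f) (K : Set Y) (hK : IsCompact K)
    (h : ∀ y ∉ K, f y = 0) : ∃ F : C₀(Y, ℂ), ∀ y, F y = f y :=
  ⟨ofTendsto f hf fun ε hε => ⟨K, hK, fun y hy => by simpa [h y hy] using hε⟩, fun _ => rfl⟩

/-- Division in `C₀(Y)`: a function which vanishes where `‖a‖ < ε` is a multiple of `a`. -/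
theorem exists_eq_mul_of_eq_zero (a f : C₀(Y, ℂ)) {ε : ℝ} (hε : 0 < ε)
    (h : ∀ y, ‖a y‖ < ε → f y = 0) : ∃ q : C₀(Y, ℂ), f = a * q := by
  have hpos : ∀ y, 0 < max (‖a y‖ ^ 2) (ε ^ 2) := fun y => lt_max_of_lt_right (by positivity)
  -- The quotient is `f * star a / ‖a‖ ^ 2`, with the denominator truncated below at `ε ^ 2`; the
  -- truncation changes it only where `f` vanishes.
  obtain ⟨q, hq⟩ := exists_eq_of_dominated
    (fun y => f y * (star (a y) / ((max (‖a y‖ ^ 2) (ε ^ 2) : ℝ) : ℂ)))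
    (by
      refine f.continuous.mul ((a.continuous.star).div ?_ fun y => ?_)
      · exact Complex.continuous_ofReal.comp
          (((continuous_norm.comp a.continuous).pow 2).max continuous_const)
      · exact_mod_cast (hpos y).ne')
    f (‖a‖ / ε ^ 2) (by
      intro y
      rw [norm_mul, norm_div, norm_star, Complex.norm_real, Real.norm_of_nonneg (hpos y).le,
        mul_comm]
      gcongr
      · exact norm_apply_le a y
      · exact le_max_right _ _)
  refine ⟨q, ?_⟩
  ext y
  rw [ZeroAtInftyContinuousMap.mul_apply, hq]
  rcases lt_or_ge ‖a y‖ ε with hy | hy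
  · simp [h y hy]
  · have h1 : max (‖a y‖ ^ 2) (ε ^ 2) = ‖a y‖ ^ 2 := max_eq_left (by gcongr)
    have h2 : a y * star (a y) = ((‖a y‖ ^ 2 : ℝ) : ℂ) := by
      simpa using Complex.mul_conj' (a y)
    have h3 : ((‖a y‖ ^ 2 : ℝ) : ℂ) ≠ 0 := by
      have : 0 < ‖a y‖ := hε.trans_le hy
      exact_mod_cast (by positivity : (‖a y‖ ^ 2) ≠ 0)
    rw [h1]
    calc f y = f y * (((‖a y‖ ^ 2 : ℝ) : ℂ) / ((‖a y‖ ^ 2 : ℝ) : ℂ)) := by rw [div_self h3, mul_one]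
      _ = f y * ((a y * star (a y)) / ((‖a y‖ ^ 2 : ℝ) : ℂ)) := by rw [h2]
      _ = _ := by ring

theorem sum_apply {ι : Type*} (s : Finset ι) (f : ι → C₀(Y, ℂ)) (y : Y) :
    (∑ k ∈ s, f k) y = ∑ k ∈ s, f k y := by
  let ev : C₀(Y, ℂ) →+ ℂ := ⟨⟨fun f => f y, rfl⟩, fun _ _ => rfl⟩
  exact map_sum ev _ _

variable [T2Space Y] [LocallyCompactSpace Y]

/-- Urysohn's lemma for elements of `C₀(Y)`. -/
theorem exists_bump {K U : Set Y} (hK : IsCompact K) (hU : IsOpen U) (hKU : K ⊆ U) :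
    ∃ (f : C₀(Y, ℂ)) (r : Y → ℝ) (S : Set Y), (∀ y, f y = r y) ∧ (∀ y, r y ∈ Set.Icc 0 1) ∧
      (∀ y ∈ K, r y = 1) ∧ IsCompact S ∧ S ⊆ U ∧ ∀ y ∉ S, r y = 0 := by
  obtain ⟨r, h1, h2, h3, h4⟩ := exists_continuousMap_one_of_isCompact_subset_isOpen hK hU hKU
  have h0 : ∀ y ∉ tsupport r, r y = 0 := fun y hy => image_eq_zero_of_notMem_tsupport hy
  obtain ⟨f, hf⟩ := exists_eq_of_isCompact (fun y => (r y : ℂ))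
    (Complex.continuous_ofReal.comp r.continuous) _ h2 (fun y hy => by simp [h0 y hy])
  exact ⟨f, r, _, hf, h4, fun y hy => h1 hy, h2, h3, h0⟩

theorem exists_bump_point {U : Set Y} (hU : IsOpen U) {y : Y} (hy : y ∈ U) :
    ∃ (f : C₀(Y, ℂ)) (r : Y → ℝ), (∀ y, f y = r y) ∧ (∀ y, r y ∈ Set.Icc 0 1) ∧ r y = 1 ∧
      ∀ z ∉ U, r z = 0 := by
  obtain ⟨f, r, S, h1, h2, h3, -, h5, h6⟩ := exists_bump isCompact_singleton hU
    (Set.singleton_subset_iff.2 hy)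
  exact ⟨f, r, h1, h2, h3 y rfl, fun z hz => h6 z fun hzS => hz (h5 hzS)⟩

theorem eq_of_forall_apply_eq {y z : Y} (h : ∀ f : C₀(Y, ℂ), f y = f z) : y = z := by
  by_contra hyz
  obtain ⟨f, r, h1, -, h3, h4⟩ := exists_bump_point (isOpen_compl_singleton (x := z)) hyz
  have := h f
  rw [h1, h1, h3, h4 z (by simp)] at this
  simp at this

/-- Compactly supported functions are dense in `C₀(Y)`. -/
theorem exists_isCompact_approx (f : C₀(Y, ℂ)) {ε : ℝ} (hε : 0 < ε) :
    ∃ (f' : C₀(Y, ℂ)) (S : Set Y), IsCompact S ∧ (∀ y ∉ S, f' y = 0) ∧ ‖f' - f‖ ≤ ε := by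
  obtain ⟨K, hK, hKf⟩ := exists_isCompact_norm_lt f hε
  obtain ⟨χ, r, S, h1, h2, h3, h4, -, h6⟩ := exists_bump hK isOpen_univ (Set.subset_univ K)
  refine ⟨χ * f, S, h4, fun y hy => by simp [h1, h6 y hy], (norm_le_iff hε.le).2 fun y => ?_⟩
  rw [ZeroAtInftyContinuousMap.sub_apply, ZeroAtInftyContinuousMap.mul_apply, h1]
  by_cases hy : y ∈ K
  · simp [h3 y hy, hε.le]
  · have : ((r y : ℝ) : ℂ) * f y - f y = ((r y - 1 : ℝ) : ℂ) * f y := by push_cast; ring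
    rw [this, norm_mul, Complex.norm_real, Real.norm_eq_abs]
    have h7 : |r y - 1| ≤ 1 := by
      obtain ⟨ha, hb⟩ := h2 y
      rw [abs_le]; constructor <;> linarith
    nlinarith [hKf y hy, norm_nonneg (f y), abs_nonneg (r y - 1)]

theorem starAlgHom_continuous {A B : Type*} [NonUnitalCStarAlgebra A] [NonUnitalCStarAlgebra B]
    (φ : A →⋆ₙₐ[ℂ] B) : Continuous φ :=
  AddMonoidHomClass.continuous_of_bound φ 1
    (by simpa only [one_mul] using! NonUnitalStarAlgHom.norm_apply_le φ)

/-- If the kernel had no common zero, then over a compact set finitely many of its elements would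
give a sum of squares `H` in the kernel, bounded away from zero there. A compactly supported `f`
with `φ f ≠ 0` would then be a multiple of `H`, hence in the kernel. -/
theorem exists_forall_ker_apply_eq_zero (φ : C₀(Y, ℂ) →⋆ₙₐ[ℂ] ℂ) {f₀ : C₀(Y, ℂ)} (h₀ : φ f₀ ≠ 0) :
    ∃ y : Y, ∀ f, φ f = 0 → f y = 0 := by
  by_contra! hcon
  choose k hk hk' using hcon
  have hφ : Continuous φ := starAlgHom_continuous φ
  have hopen : IsOpen {f | φ f ≠ 0} := isOpen_ne_fun hφ continuous_const
  obtain ⟨ε, hε, hball⟩ := Metric.isOpen_iff.1 hopen f₀ h₀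
  obtain ⟨f, S, hS, hfS, hf⟩ := exists_isCompact_approx f₀ (half_pos hε)
  have hφf : φ f ≠ 0 := hball (by rw [Metric.mem_ball, dist_eq_norm]; linarith)
  obtain ⟨t, -, ht⟩ := hS.elim_nhds_subcover (fun y => {z | k y z ≠ 0}) fun y _ =>
    (isOpen_ne_fun (k y).continuous continuous_const).mem_nhds (hk' y)
  set H : C₀(Y, ℂ) := ∑ y ∈ t, star (k y) * k y
  have hcoe : ∀ z, H z = ((∑ y ∈ t, ‖k y z‖ ^ 2 : ℝ) : ℂ) := by
    intro z
    rw [sum_apply, Complex.ofReal_sum]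
    refine Finset.sum_congr rfl fun y _ => ?_
    simpa using Complex.conj_mul' (k y z)
  have hφH : φ H = 0 := by
    rw [map_sum]
    exact Finset.sum_eq_zero fun y _ => by rw [map_mul, hk, mul_zero]
  have hpos : ∀ z ∈ S, 0 < ‖H z‖ := by
    intro z hz
    rw [norm_pos_iff, hcoe]
    obtain ⟨y, hy, hyz⟩ := Set.mem_iUnion₂.1 (ht hz)
    have : 0 < ∑ y ∈ t, ‖k y z‖ ^ 2 :=
      Finset.sum_pos' (fun _ _ => by positivity)
        ⟨y, hy, by have := norm_pos_iff.2 hyz; positivity⟩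
    exact_mod_cast this.ne'
  obtain ⟨δ, hδ, hδS⟩ := hS.exists_forall_le' (f := fun z => ‖H z‖)
    (continuous_norm.comp H.continuous).continuousOn hpos
  obtain ⟨q, hq⟩ := exists_eq_mul_of_eq_zero H f hδ fun z hz => by
    by_contra hfz
    exact absurd (hδS z (by_contra fun hzS => hfz (hfS z hzS))) (not_le.2 hz)
  exact hφf (by rw [hq, map_mul, hφH, zero_mul])

/-- Every character of `C₀(Y)` is the evaluation at a point. -/
theorem exists_forall_eq_apply (φ : C₀(Y, ℂ) →⋆ₙₐ[ℂ] ℂ) {f₀ : C₀(Y, ℂ)} (h₀ : φ f₀ ≠ 0) :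
    ∃ y : Y, ∀ f, φ f = f y := by
  obtain ⟨y, hy⟩ := exists_forall_ker_apply_eq_zero φ h₀
  refine ⟨y, ?_⟩
  obtain ⟨c, hc⟩ : ∃ c : ℂ, ∀ f, f y = c * φ f := by
    refine ⟨f₀ y / φ f₀, fun f => ?_⟩
    have := hy (f - (φ f / φ f₀) • f₀) (by
      rw [map_sub, map_smul, smul_eq_mul, div_mul_cancel₀ _ h₀, sub_self])
    rw [ZeroAtInftyContinuousMap.sub_apply, ZeroAtInftyContinuousMap.smul_apply, sub_eq_zero,
      smul_eq_mul] at this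
    rw [this]; ring
  -- Multiplicativity fixes the constant: with `b y = 1` both `c * φ b` and `c * φ b ^ 2` equal `1`.
  obtain ⟨b, r, hb, -, hr, -⟩ := exists_bump_point isOpen_univ (Set.mem_univ y)
  have hby : b y = 1 := by rw [hb, hr]; simp
  have h1 := hc b
  have h2 := hc (b * b)
  rw [ZeroAtInftyContinuousMap.mul_apply, map_mul, hby] at h2
  rw [hby] at h1
  have hc1 : c = 1 := by
    have : c * (φ b * φ b) = c * φ b * φ b := by ring
    rw [this, ← h1] at h2
    have hb1 : φ b = 1 := by simpa using h2.symm
    rw [hb1] at h1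
    simpa using h1.symm
  intro f
  rw [hc f, hc1, one_mul]

/-- Evaluation at a point as a character of `C₀(Y)`. -/
noncomputable def evalHom (y : Y) : C₀(Y, ℂ) →⋆ₙₐ[ℂ] ℂ where
  toFun f := f y
  map_smul' _ _ := rfl
  map_zero' := rfl
  map_add' _ _ := rfl
  map_mul' _ _ := rfl
  map_star' _ := rfl

/-- Evaluation at `y` after `e` is a character, nonzero because `e` is onto, hence an evaluation at
some `τ y`. Continuity of `τ` comes from the open sets where the functions `e b` do not vanish, for
bump functions `b`. -/
theorem exists_point_of_starAlgEquiv (e : C₀(Y, ℂ) ≃⋆ₐ[ℂ] C₀(Y, ℂ)) :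
    ∃ τ : Y → Y, Continuous τ ∧ ∀ f y, e f y = f (τ y) := by
  have h : ∀ y, ∃ z, ∀ f, e f y = f z := by
    intro y
    obtain ⟨b, r, hb, -, hr, -⟩ := exists_bump_point isOpen_univ (Set.mem_univ y)
    let φ : C₀(Y, ℂ) →⋆ₙₐ[ℂ] ℂ := (evalHom y).comp (e : C₀(Y, ℂ) →⋆ₙₐ[ℂ] C₀(Y, ℂ))
    have hφ : ∀ f, φ f = e f y := fun f => rfl
    exact exists_forall_eq_apply φ (f₀ := e.symm b) (by
      rw [hφ, StarAlgEquiv.apply_symm_apply, hb, hr]; simp)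
  choose τ hτ using h
  refine ⟨τ, ?_, fun f y => hτ y f⟩
  rw [continuous_iff_continuousAt]
  intro y U hU
  obtain ⟨V, hVU, hV, hyV⟩ := mem_nhds_iff.1 hU
  obtain ⟨b, r, hb, -, hr, hr0⟩ := exists_bump_point hV hyV
  have hopen : IsOpen {z | e b z ≠ 0} := isOpen_ne_fun (e b).continuous continuous_const
  refine mem_map.2 (mem_of_superset (hopen.mem_nhds ?_) ?_)
  · simp [hτ, hb, hr]
  · intro z hz
    refine hVU (by_contra fun hzV => hz ?_)
    rw [hτ, hb, hr0 _ hzV]; simp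

theorem homeoAction_apply {Y : Type*} [TopologicalSpace Y] (g : Y ≃ₜ Y) (f : C₀(Y, ℂ)) (y : Y) :
    homeoAction Y g f y = f (g⁻¹ y) := rfl

/-- Every *-automorphism of `C₀(Y)` is induced by a homeomorphism of `Y`. -/
theorem homeoAction_bijective : Function.Bijective (homeoAction Y) := by
  constructor
  · intro g g' h
    rw [← inv_inj]
    ext y
    refine eq_of_forall_apply_eq fun f => ?_
    rw [← homeoAction_apply, ← homeoAction_apply, h]
  · intro e
    obtain ⟨τ, hτ, h⟩ := exists_point_of_starAlgEquiv e
    obtain ⟨τ', hτ', h'⟩ := exists_point_of_starAlgEquiv e.symm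
    refine ⟨⟨⟨τ', τ, fun y => ?_, fun y => ?_⟩, hτ', hτ⟩, ?_⟩
    · refine eq_of_forall_apply_eq fun f => ?_
      rw [← h, ← h', StarAlgEquiv.symm_apply_apply]
    · refine eq_of_forall_apply_eq fun f => ?_
      rw [← h', ← h, StarAlgEquiv.apply_symm_apply]
    · ext f y
      rw [homeoAction_apply, h]
      rfl

theorem exists_homeoAction_comp {G : Type*} [Group G] (α : G →* (C₀(Y, ℂ) ≃⋆ₐ[ℂ] C₀(Y, ℂ))) :
    ∃ σ : G →* (Y ≃ₜ Y), α = (homeoAction Y).comp σ := by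
  let e := MulEquiv.ofBijective (homeoAction Y) homeoAction_bijective
  refine ⟨e.symm.toMonoidHom.comp α, ?_⟩
  ext1 g
  exact (e.apply_symm_apply (α g)).symm

omit [LocallyCompactSpace Y] in
/-- Extension by zero of a continuous function on a compact set, vanishing off an open subset. -/
theorem exists_extension_by_zero {K U : Set Y} (hK : IsCompact K) (hU : IsOpen U) (hUK : U ⊆ K)
    (f : C(K, ℂ)) (hf : ∀ z : K, (z : Y) ∉ U → f z = 0) :
    ∃ F : C₀(Y, ℂ), (∀ z : K, F z = f z) ∧ ∀ z ∉ U, F z = 0 := by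
  classical
  set F : Y → ℂ := fun z => if hz : z ∈ K then f ⟨z, hz⟩ else 0
  have hFK : ∀ z : K, F z = f z := fun z => by simp [F]
  have hFU : ∀ z ∉ U, F z = 0 := by
    intro z hz
    by_cases hzK : z ∈ K
    · rw [hFK ⟨z, hzK⟩, hf _ hz]
    · simp [F, hzK]
  have h1 : ContinuousOn F K := by
    rw [continuousOn_iff_continuous_domRestrict]
    convert f.continuous using 1
    funext z
    exact hFK z
  have h2 : ContinuousOn F Uᶜ := continuousOn_const.congr fun z hz => hFU z hz
  -- `K` and the complement of `U` are closed and cover `Y`, and `F` is continuous on each.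
  have hcont : Continuous F := by
    rw [← continuousOn_univ]
    refine (h1.union_of_isClosed h2 hK.isClosed hU.isClosed_compl).mono fun z _ => ?_
    by_cases hz : z ∈ U
    · exact Or.inl (hUK hz)
    · exact Or.inr hz
  obtain ⟨F', hF'⟩ := exists_eq_of_isCompact F hcont K hK fun z hz => hFU z fun h => hz (hUK h)
  exact ⟨F', fun z => by rw [hF', hFK], fun z hz => by rw [hF', hFU z hz]⟩

end ZeroAtInfty

/-! ### Orbit maps of finite groups -/

section OrbitMap

variable {X X' G : Type*} [TopologicalSpace X] [TopologicalSpace X'] [Group G] [Finite G]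
  {σ : G →* (X' ≃ₜ X')} {π : X' → X}

/-- The saturation of a closed set is the union of its finitely many translates. -/
theorem isClosedMap_of_orbits (hπ : Continuous π) (hsurj : Function.Surjective π)
    (ho : IsOpenMap π) (hfib : ∀ y y', π y = π y' ↔ ∃ g, σ g y = y') : IsClosedMap π := by
  intro C hC
  rw [← (ho.isQuotientMap hπ hsurj).isClosed_preimage]
  have : π ⁻¹' (π '' C) = ⋃ g, σ g '' C := by
    ext z
    simp only [Set.mem_preimage, Set.mem_image, Set.mem_iUnion]
    constructor
    · rintro ⟨y, hy, hyz⟩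
      obtain ⟨g, hg⟩ := (hfib _ _).1 hyz
      exact ⟨g, y, hy, hg⟩
    · rintro ⟨g, y, hy, hyz⟩
      exact ⟨y, hy, (hfib _ _).2 ⟨g, hyz⟩⟩
  rw [this]
  exact isClosed_iUnion_of_finite fun g => (σ g).isClosedMap _ hC

omit [TopologicalSpace X] in
theorem finite_fiber_of_orbits (hsurj : Function.Surjective π)
    (hfib : ∀ y y', π y = π y' ↔ ∃ g, σ g y = y') (x : X) : (π ⁻¹' {x}).Finite := by
  obtain ⟨y, rfl⟩ := hsurj x
  refine (Set.finite_range fun g => σ g y).subset fun z hz => ?_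
  exact (hfib _ _).1 hz.symm

theorem isProperMap_of_orbits (hπ : Continuous π) (hsurj : Function.Surjective π)
    (ho : IsOpenMap π) (hfib : ∀ y y', π y = π y' ↔ ∃ g, σ g y = y') : IsProperMap π :=
  isProperMap_iff_isClosedMap_and_compact_fibers.2
    ⟨hπ, isClosedMap_of_orbits hπ hsurj ho hfib,
      fun x => (finite_fiber_of_orbits hsurj hfib x).isCompact⟩

/-- Functions which are constant on the fibres descend along an open surjection. -/
theorem exists_comp_eq (hπ : Continuous π) (hsurj : Function.Surjective π) (ho : IsOpenMap π)
    (f : C₀(X', ℂ)) (hf : ∀ y y', π y = π y' → f y = f y') :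
    ∃ h : C₀(X, ℂ), ∀ y, f y = h (π y) := by
  set h : X → ℂ := fun x => f (hsurj x).choose
  have hh : ∀ y, f y = h (π y) := fun y => hf _ _ (hsurj (π y)).choose_spec.symm
  have hcont : Continuous h := by
    rw [(ho.isQuotientMap hπ hsurj).continuous_iff]
    convert f.continuous using 1
    funext y
    exact (hh y).symm
  refine ⟨ofTendsto h hcont fun ε hε => ?_, hh⟩
  obtain ⟨K, hK, hKf⟩ := exists_isCompact_norm_lt f hε
  refine ⟨π '' K, hK.image hπ, fun x hx => hKf _ fun hxK => hx ⟨_, hxK, (hsurj x).choose_spec⟩⟩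

end OrbitMap

end NCCovering

/-! ### Finite generation forces stabilizers to act trivially nearby -/

namespace NCCovering

open Topology Filter

/-- At a zero of `t` the quotient has the value `0` by the convention for division, and the bound
`‖f / t‖ ≤ |t|` gives continuity there. -/
theorem continuous_div_of_norm_le_sq {Y : Type*} [TopologicalSpace Y] {f : Y → ℂ} {t : Y → ℝ}
    (hf : Continuous f) (ht : Continuous t) (h : ∀ y, ‖f y‖ ≤ t y ^ 2) :
    Continuous fun y => f y / (t y : ℂ) := by
  rw [continuous_iff_continuousAt]
  intro y
  by_cases hy : t y = 0
  · have hb : ∀ z, ‖f z / (t z : ℂ)‖ ≤ |t z| := by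
      intro z
      rw [norm_div, Complex.norm_real, Real.norm_eq_abs]
      refine div_le_of_le_mul₀ (abs_nonneg _) (abs_nonneg _) ?_
      rw [← sq, sq_abs]
      exact h z
    have h0 : f y / (t y : ℂ) = 0 := by simp [hy]
    rw [ContinuousAt, h0]
    refine squeeze_zero_norm hb ?_
    have := (continuous_abs.comp ht).tendsto y
    simpa [hy, Function.comp_def] using this
  · exact hf.continuousAt.div (Complex.continuous_ofReal.comp ht).continuousAt
      (by exact_mod_cast hy)

section Generators

variable {Y G : Type*} [TopologicalSpace Y] [T2Space Y] [LocallyCompactSpace Y] [Group G]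
  (σ : G →* (Y ≃ₜ Y))

/-- The function `z ↦ ∑ g, (f z - f (g⁻¹ z))`, the sum being over a family of group elements. -/
noncomputable def groupDiff {ι : Type*} [Fintype ι] (s : ι → G) (f : Y → ℂ) (z : Y) : ℂ :=
  ∑ m, (f z - f (σ (s m)⁻¹ z))

omit [T2Space Y] [LocallyCompactSpace Y] in
-- For a subgroup, `groupDiff` is the order of `H` times the difference of `f` and its average, and
-- that difference averages to zero.
theorem sum_groupDiff_subgroup (H : Subgroup G) [Fintype H] (f : Y → ℂ) (z : Y) :
    ∑ h : H, groupDiff σ (fun h : H => (h : G)) f (σ (h : G)⁻¹ z) = 0 := by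
  have h1 : ∀ h : H, ∑ h' : H, f (σ (h' : G)⁻¹ (σ (h : G)⁻¹ z)) = ∑ h' : H, f (σ (h' : G)⁻¹ z) := by
    intro h
    refine Fintype.sum_equiv (Equiv.mulLeft h) _ _ fun h' => ?_
    simp [mul_inv_rev, map_mul, Homeomorph.mul_apply]
  have h2 : ∀ h : H, groupDiff σ (fun h : H => (h : G)) f (σ (h : G)⁻¹ z) =
      (Fintype.card H : ℂ) * f (σ (h : G)⁻¹ z) - ∑ h' : H, f (σ (h' : G)⁻¹ z) := by
    intro h
    rw [groupDiff, Finset.sum_sub_distrib, h1]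
    simp
  rw [Finset.sum_congr rfl fun h _ => h2 h, Finset.sum_sub_distrib, ← Finset.mul_sum]
  simp

/-- If the functions `f - average of f` (times a cutoff) are combinations of finitely many of
them, with continuous coefficients, then the stabilizer of `y` fixes a neighbourhood of `y`. -/
theorem eventually_fixed_of_generators (y : Y) (H : Subgroup G) [Fintype H]
    (hH : ∀ h ∈ H, σ h y = y) {n : ℕ} (E v : Fin n → C₀(Y, ℂ)) (a : C₀(Y, ℂ)) (ha : a y ≠ 0)
    (hv : ∀ k z, v k z = groupDiff σ (fun h : H => (h : G)) (E k) z)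
    (hgen : ∀ q : C₀(Y, ℂ), ∃ c : Fin n → C₀(Y, ℂ), ∀ z,
      groupDiff σ (fun h : H => (h : G)) q z * a z ^ 3 = ∑ k, v k z * c k z) :
    ∀ᶠ z in 𝓝 y, ∀ h ∈ H, σ h z = z := by
  have hsum : ∀ k z, ∑ h : H, v k (σ (h : G)⁻¹ z) = 0 := by
    intro k z
    simp_rw [hv]
    exact sum_groupDiff_subgroup σ H _ z
  have hvy : ∀ k, v k y = 0 := by
    intro k
    have := hsum k y
    have hfix : ∀ h : H, σ (h : G)⁻¹ y = y := fun h => hH _ (H.inv_mem h.2)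
    simp only [hfix, Finset.sum_const, Finset.card_univ, nsmul_eq_mul, mul_eq_zero,
      Nat.cast_eq_zero, Fintype.card_ne_zero, false_or] at this
    exact this
  -- the common factor
  set N : C₀(Y, ℂ) := ∑ k, ∑ h : H,
    star (homeoAction Y (σ h) (v k)) * homeoAction Y (σ h) (v k)
  set S : Y → ℝ := fun z => ∑ k, ∑ h : H, ‖v k (σ (h : G)⁻¹ z)‖ ^ 2
  have hS0 : ∀ z, 0 ≤ S z := fun z => by positivity
  have hN : ∀ z, N z = (S z : ℂ) := by
    intro z
    simp only [N, S, sum_apply, Complex.ofReal_sum]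
    refine Finset.sum_congr rfl fun k _ => Finset.sum_congr rfl fun h _ => ?_
    rw [ZeroAtInftyContinuousMap.mul_apply, ZeroAtInftyContinuousMap.star_apply,
      homeoAction_apply, ← map_inv]
    simpa using Complex.conj_mul' (v k (σ (h : G)⁻¹ z))
  have hNn : ∀ z, ‖N z‖ = S z := fun z => by
    rw [hN, Complex.norm_real, Real.norm_of_nonneg (hS0 z)]
  have hScont : Continuous S := by
    have : S = fun z => ‖N z‖ := funext fun z => (hNn z).symm
    rw [this]
    exact continuous_norm.comp N.continuous
  -- `S` is quadratic in the `v k`, so its fourth root satisfies `‖v k‖ ≤ t ^ 2`. Hence `v k / t` is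
  -- still continuous, while `t` is invariant and vanishes at `y`.
  set t : Y → ℝ := fun z => √(√(S z))
  have ht : Continuous t := hScont.sqrt.sqrt
  have ht0 : ∀ z, 0 ≤ t z := fun z => Real.sqrt_nonneg _
  have htsq : ∀ z, t z ^ 2 = √(S z) := fun z => Real.sq_sqrt (Real.sqrt_nonneg _)
  have hty : t y = 0 := by
    have hfix : ∀ h : H, σ (h : G)⁻¹ y = y := fun h => hH _ (H.inv_mem h.2)
    simp only [t, S, hfix, hvy]
    simp
  have hvt : ∀ k z, ‖v k z‖ ≤ t z ^ 2 := by
    intro k z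
    rw [htsq]
    refine Real.le_sqrt_of_sq_le ?_
    have h1 : ‖v k z‖ ^ 2 ≤ ∑ h : H, ‖v k (σ (h : G)⁻¹ z)‖ ^ 2 := by
      have := Finset.single_le_sum (f := fun h : H => ‖v k (σ (h : G)⁻¹ z)‖ ^ 2)
        (fun h _ => by positivity) (Finset.mem_univ (1 : H))
      simpa using this
    exact h1.trans (Finset.single_le_sum
      (f := fun k => ∑ h : H, ‖v k (σ (h : G)⁻¹ z)‖ ^ 2) (fun k _ => by positivity)
      (Finset.mem_univ k))
  have htinv : ∀ (h : H) z, t (σ (h : G)⁻¹ z) = t z := by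
    intro h z
    simp only [t, S]
    congr 2
    refine Finset.sum_congr rfl fun k _ => ?_
    refine Fintype.sum_equiv (Equiv.mulLeft h) _ _ fun h' => ?_
    simp [mul_inv_rev, map_mul, Homeomorph.mul_apply]
  have hw : ∀ k, ∃ w : C₀(Y, ℂ), ∀ z, w z = v k z / (t z : ℂ) := by
    intro k
    refine ⟨ofTendsto _ (continuous_div_of_norm_le_sq (v k).continuous ht (hvt k))
      fun ε hε => ?_, fun _ => rfl⟩
    obtain ⟨K, hK, hKN⟩ := exists_isCompact_norm_lt N (ε := ε ^ 4) (by positivity)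
    refine ⟨K, hK, fun z hz => ?_⟩
    have h1 : t z < ε := by
      have := hKN z hz
      rw [hNn] at this
      rw [Real.sqrt_lt' hε, Real.sqrt_lt' (by positivity)]
      calc S z < ε ^ 4 := this
        _ = _ := by ring
    refine lt_of_le_of_lt ?_ h1
    rw [norm_div, Complex.norm_real, Real.norm_of_nonneg (ht0 z)]
    refine div_le_of_le_mul₀ (ht0 z) (ht0 z) ?_
    rw [← sq]
    exact hvt k z
  choose w hw using hw
  have hvw : ∀ k z, v k z = t z * w k z := by
    intro k z
    rw [hw]
    by_cases hz : t z = 0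
    · have := hvt k z
      rw [hz] at this
      have h0 : v k z = 0 := by simpa using this
      simp [h0]
    · rw [mul_div_cancel₀ _ (by exact_mod_cast hz)]
  have hwdiff : ∀ k z, groupDiff σ (fun h : H => (h : G)) (w k) z = Fintype.card H * w k z := by
    intro k z
    rw [groupDiff, Finset.sum_sub_distrib]
    have : ∑ h : H, w k (σ (h : G)⁻¹ z) = 0 := by
      simp_rw [hw, htinv]
      rw [← Finset.sum_div, hsum, zero_div]
    rw [this]
    simp
  -- Applied to `w k` itself, the hypothesis reads `card H * w k * a ^ 3 = t * ∑ l, w l * c k l`.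
  -- Summing norms over `k`, the factor `t * M` is too small near `y` unless all `w k` vanish.
  choose c hc using fun k => hgen (w k)
  set M : ℝ := ∑ k, ∑ l, ‖c k l‖
  have hopen : ∀ᶠ z in 𝓝 y, t z * M < Fintype.card H * ‖a z‖ ^ 3 := by
    have h1 : Continuous fun z => t z * M := ht.mul continuous_const
    have h2 : Continuous fun z => (Fintype.card H : ℝ) * ‖a z‖ ^ 3 :=
      continuous_const.mul ((continuous_norm.comp a.continuous).pow 3)
    refine (h1.tendsto y).eventually_lt (h2.tendsto y) ?_
    rw [hty, zero_mul]
    have : 0 < ‖a y‖ := norm_pos_iff.2 ha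
    have hc : 0 < (Fintype.card H : ℝ) := by exact_mod_cast Fintype.card_pos
    positivity
  filter_upwards [hopen] with z hz
  have haz : a z ≠ 0 := by
    intro h0
    rw [h0, norm_zero] at hz
    have : 0 ≤ t z * M := mul_nonneg (ht0 z) (by positivity)
    norm_num at hz
    linarith
  -- the generators vanish at `z`
  have hsumw : ∑ k, ‖w k z‖ = 0 := by
    by_contra hne
    have hpos : 0 < ∑ k, ‖w k z‖ := lt_of_le_of_ne (by positivity) (Ne.symm hne)
    have hk : ∀ k, Fintype.card H * ‖a z‖ ^ 3 * ‖w k z‖ ≤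
        t z * (∑ l, ‖w l z‖) * ∑ l, ‖c k l‖ := by
      intro k
      have h1 := hc k z
      rw [hwdiff] at h1
      have h2 := congr_arg norm h1
      rw [norm_mul, norm_mul, norm_pow, Complex.norm_natCast] at h2
      calc Fintype.card H * ‖a z‖ ^ 3 * ‖w k z‖ = Fintype.card H * ‖w k z‖ * ‖a z‖ ^ 3 := by ring
        _ = ‖∑ l, v l z * c k l z‖ := h2
        _ ≤ ∑ l, ‖v l z * c k l z‖ := norm_sum_le _ _
        _ ≤ ∑ l, t z * (∑ l, ‖w l z‖) * ‖c k l‖ := by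
            refine Finset.sum_le_sum fun l _ => ?_
            rw [norm_mul, hvw, norm_mul, Complex.norm_real, Real.norm_of_nonneg (ht0 z)]
            have h3 : ‖w l z‖ ≤ ∑ l, ‖w l z‖ := Finset.single_le_sum
              (f := fun l => ‖w l z‖) (fun _ _ => norm_nonneg _) (Finset.mem_univ l)
            have h4 := norm_apply_le (c k l) z
            have h5 := ht0 z
            gcongr
        _ = _ := (Finset.mul_sum _ _ _).symm
    have := Finset.sum_le_sum fun k (_ : k ∈ Finset.univ) => hk k
    rw [← Finset.mul_sum, ← Finset.mul_sum] at this
    have h6 : t z * M * (∑ k, ‖w k z‖) < Fintype.card H * ‖a z‖ ^ 3 * ∑ k, ‖w k z‖ :=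
      mul_lt_mul_of_pos_right hz hpos
    have h7 : t z * (∑ l, ‖w l z‖) * M = t z * M * (∑ k, ‖w k z‖) := by ring
    linarith
  have hvz : ∀ k, v k z = 0 := by
    intro k
    have := (Finset.sum_eq_zero_iff_of_nonneg fun k _ => norm_nonneg (w k z)).1 hsumw k
      (Finset.mem_univ k)
    rw [hvw, norm_eq_zero.1 this, mul_zero]
  intro h hh
  by_contra hne
  -- All terms `1 - r (σ h'⁻¹ z)` are nonnegative and their sum must vanish, but the term of `h⁻¹`
  -- equals `1`.
  obtain ⟨q, r, hq, hr01, hrz, hr0⟩ := exists_bump_point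
    (isOpen_compl_singleton (x := σ h z)) (y := z) (by simpa using Ne.symm hne)
  obtain ⟨d, hd⟩ := hgen q
  have h1 := hd z
  simp only [hvz, zero_mul, Finset.sum_const_zero, mul_eq_zero, haz,
    or_false, ne_eq, OfNat.ofNat_ne_zero, not_false_eq_true, pow_eq_zero_iff] at h1
  have h2 : groupDiff σ (fun h : H => (h : G)) q z =
      ((∑ h' : H, (1 - r (σ (h' : G)⁻¹ z)) : ℝ) : ℂ) := by
    simp [groupDiff, hq, hrz]
  rw [h2] at h1
  have h3 : ∑ h' : H, (1 - r (σ (h' : G)⁻¹ z)) = 0 := by exact_mod_cast h1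
  have h4 := (Finset.sum_eq_zero_iff_of_nonneg fun (h' : H) _ => by
    linarith [(hr01 (σ (h' : G)⁻¹ z)).2]).1 h3 ⟨h⁻¹, H.inv_mem hh⟩ (Finset.mem_univ _)
  simp [hr0 (σ h z) (by simp)] at h4

end Generators

end NCCovering

/-! ### From module generators of a compactification to functions -/

namespace NCCovering

open Topology Filter

theorem exists_generators_of_finite {B B' : Type*} [CStarAlgebra B] [CStarAlgebra B']
    (i : B →⋆ₐ[ℂ] B') (h : Module.Finite Bᵐᵒᵖ (RightModule i)) :
    ∃ (n : ℕ) (e : Fin n → B'), ∀ b : B', ∃ c : Fin n → B, b = ∑ k, e k * i (c k) := by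
  obtain ⟨n, e, he⟩ := Module.Finite.exists_fin (R := Bᵐᵒᵖ) (M := RightModule i)
  refine ⟨n, e, fun b => ?_⟩
  have hb : (show RightModule i from b) ∈ Submodule.span Bᵐᵒᵖ (Set.range e) := by
    rw [he]; trivial
  obtain ⟨c, hc⟩ := (Submodule.mem_span_range_iff_exists_fun _).1 hb
  exact ⟨fun k => (c k).unop, hc.symm⟩

section Extract

variable {Y G : Type*} [TopologicalSpace Y] [Group G]

/-- The algebraic input for `eventually_fixed_of_generators`: a covering with compactification
provides finitely many generators. -/
theorem exists_generators [Finite G] (σ : G →* (Y ≃ₜ Y)) (J : ClosedIdeal C₀(Y, ℂ))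
    (hJ : ∀ g : G, (homeoAction Y).comp σ g '' J.carrier = J.carrier) {B B' : Type*}
    [CStarAlgebra B] [CStarAlgebra B'] {i : B →⋆ₐ[ℂ] B'} {β : G →* (B' ≃⋆ₐ[ℂ] B')}
    {j : J.toNonUnitalStarSubalgebra →⋆ₙₐ[ℂ] B'} (hj : Function.Injective j)
    (hess : HasEssentialIdealRange j) (hcov : IsUnitalFiniteFoldCovering i β)
    (heq : ∀ g a, β g (j a) = j (J.restrictAction ((homeoAction Y).comp σ) hJ g a))
    {y : Y} {a₁ : C₀(Y, ℂ)} (ha₁ : a₁ ∈ J.carrier) (hy : a₁ y ≠ 0) {ι : Type*} [Fintype ι]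
    (s : ι → G) :
    ∃ (n : ℕ) (E v : Fin n → C₀(Y, ℂ)) (a : C₀(Y, ℂ)), a y ≠ 0 ∧
      (∀ k z, v k z = groupDiff σ s (E k) z) ∧
      ∀ q : C₀(Y, ℂ), ∃ c : Fin n → C₀(Y, ℂ), ∀ z,
        groupDiff σ s q z * a z ^ 3 = ∑ k, v k z * c k z := by
  have := Fintype.ofFinite G
  set α := (homeoAction Y).comp σ
  have hα : ∀ g (f : C₀(Y, ℂ)) z, α g f z = f (σ g⁻¹ z) := by
    intro g f z
    rw [map_inv]; rfl
  -- an invariant element of the ideal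
  set a : C₀(Y, ℂ) := ∑ g, α g (star a₁ * a₁)
  have haJ : a ∈ J.toNonUnitalStarSubalgebra := by
    refine sum_mem fun g _ => ?_
    exact (hJ g).subset ⟨_, J.ideal_left _ _ ha₁, rfl⟩
  have hainv : ∀ g z, a (σ g⁻¹ z) = a z := by
    intro g z
    simp only [a, sum_apply, hα]
    refine Fintype.sum_equiv (Equiv.mulLeft g) _ _ fun h => ?_
    simp [mul_inv_rev, map_mul, Homeomorph.mul_apply]
  have hav : ∀ z, a z = ((∑ g, ‖a₁ (σ g⁻¹ z)‖ ^ 2 : ℝ) : ℂ) := by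
    intro z
    rw [sum_apply, Complex.ofReal_sum]
    refine Finset.sum_congr rfl fun g _ => ?_
    rw [hα]
    simpa using Complex.conj_mul' (a₁ (σ g⁻¹ z))
  have hay : a y ≠ 0 := by
    rw [hav]
    have : 0 < ∑ g, ‖a₁ (σ g⁻¹ y)‖ ^ 2 := by
      refine Finset.sum_pos' (fun _ _ => by positivity) ⟨1, Finset.mem_univ _, ?_⟩
      have := norm_pos_iff.2 hy
      simp only [inv_one, map_one, Homeomorph.one_apply]
      positivity
    exact_mod_cast this.ne'
  let aJ : J.toNonUnitalStarSubalgebra := ⟨a, haJ⟩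
  have hβa : ∀ g, β g (j aJ) = j aJ := by
    intro g
    rw [heq]
    congr 1
    refine Subtype.ext ?_
    ext z
    exact (hα g a z).trans (hainv g z)
  have hcomm : ∀ p q : J.toNonUnitalStarSubalgebra, p * q = q * p := fun p q =>
    Subtype.ext (mul_comm _ _)
  -- Elements of `B'` need not be functions on `Y`; multiplied by `a` they land in the ideal. `T` is
  -- multiplicative up to one factor `a`, by commutativity of the ideal alone.
  choose T hT using fun b => hess.mul_mem_left b aJ
  have hTmul : ∀ b c, T (b * c) * aJ = T b * T c := by
    intro b c
    apply hj
    calc j (T (b * c) * aJ) = b * (c * j aJ * j aJ) := by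
          rw [map_mul, hT]; simp only [mul_assoc]
      _ = b * (j aJ * (c * j aJ)) := by rw [← hT c, ← map_mul, ← map_mul, hcomm]
      _ = j (T b * T c) := by rw [map_mul, hT, hT, mul_assoc]
  have hTadd : ∀ b c, T (b + c) = T b + T c := by
    intro b c
    apply hj
    rw [map_add, hT, hT, hT, add_mul]
  have hTβ : ∀ g b z, (T (β g b)).1 z = (T b).1 (σ g⁻¹ z) := by
    intro g b z
    have : T (β g b) = J.restrictAction α hJ g (T b) := by
      apply hj
      rw [← heq, hT, hT, map_mul, hβa]
    rw [this]
    exact hα g _ z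
  have hTj : ∀ p, T (j p) = p * aJ := by
    intro p
    apply hj
    rw [hT, map_mul]
  let Tz : Y → (B' →+ ℂ) := fun z => AddMonoidHom.mk' (fun b => (T b).1 z)
    (fun b c => by rw [hTadd]; rfl)
  have hTz : ∀ z b, Tz z b = (T b).1 z := fun _ _ => rfl
  have hTzmul : ∀ z b c, Tz z (b * c) * a z = Tz z b * Tz z c := by
    intro z b c
    exact congr_arg (fun p : J.toNonUnitalStarSubalgebra => p.1 z) (hTmul b c)
  -- the difference operator
  let D : B' →+ B' := AddMonoidHom.mk' (fun b => ∑ m, (b - β (s m) b)) (fun b c => by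
    rw [← Finset.sum_add_distrib]
    refine Finset.sum_congr rfl fun m _ => ?_
    rw [map_add]; abel)
  have hD : ∀ b, D b = ∑ m, (b - β (s m) b) := fun _ => rfl
  -- The action fixes the image of `B`, so `D` is linear over `B` and maps combinations of the `e k`
  -- to combinations of the `D (e k)`.
  have hDi : ∀ b c, D (b * i c) = D b * i c := by
    intro b c
    rw [hD, hD, Finset.sum_mul]
    refine Finset.sum_congr rfl fun m _ => ?_
    have : β (s m) (i c) = i c := (hcov.fixedPoints.subset ⟨c, rfl⟩ : _) (s m)
    rw [map_mul, this, sub_mul]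
  have hTD : ∀ b z, Tz z (D b) = groupDiff σ s (T b).1 z := by
    intro b z
    rw [hD, map_sum, groupDiff]
    refine Finset.sum_congr rfl fun m _ => ?_
    rw [map_sub, hTz, hTz, hTβ]
  obtain ⟨n, e, he⟩ := exists_generators_of_finite i hcov.finite
  refine ⟨n, fun k => (T (e k)).1, fun k => (T (D (e k))).1, a, hay, fun k z => hTD _ z, ?_⟩
  intro q
  -- The cube of `a` arises here: one factor puts `q` into the ideal, `T` adds a second, and
  -- multiplicativity of `T` a third.
  let p : J.toNonUnitalStarSubalgebra := ⟨q * a, J.ideal_left _ _ haJ⟩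
  obtain ⟨c, hc⟩ := he (j p)
  refine ⟨fun k => (T (i (c k))).1, fun z => ?_⟩
  have h1 : Tz z (D (j p)) = groupDiff σ s q z * a z ^ 2 := by
    have hTjp : ∀ w, (T (j p)).1 w = q w * a w * a w := fun w => by rw [hTj]; rfl
    rw [hTD, groupDiff, groupDiff, Finset.sum_mul]
    refine Finset.sum_congr rfl fun m _ => ?_
    rw [hTjp, hTjp, hainv]
    ring
  have h2 : Tz z (D (j p)) * a z = ∑ k, Tz z (D (e k)) * Tz z (i (c k)) := by
    rw [hc, map_sum, map_sum, Finset.sum_mul]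
    refine Finset.sum_congr rfl fun k _ => ?_
    rw [hDi, hTzmul]
  calc groupDiff σ s q z * a z ^ 3 = Tz z (D (j p)) * a z := by rw [h1]; ring
    _ = _ := h2

end Extract

/-! ### Noncommutative coverings of commutative algebras are regular coverings -/

section Covering

variable {X X' G : Type*} [TopologicalSpace X] [T2Space X] [LocallyCompactSpace X]
  [TopologicalSpace X'] [T2Space X'] [LocallyCompactSpace X'] [Group G]
  {π : X' → X} {σ : G →* (X' ≃ₜ X')} {ι : C₀(X, ℂ) →⋆ₙₐ[ℂ] C₀(X', ℂ)}

omit [T2Space X'] [LocallyCompactSpace X'] in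
theorem apply_eq_of_fixedPoints (hι : ∀ f x, ι f x = f (π x))
    (hfix : Set.range ι = {a | ∀ g : G, (homeoAction X').comp σ g a = a}) (g : G) (y : X') :
    π (σ g y) = π y := by
  refine eq_of_forall_apply_eq fun h => ?_
  have h1 : (homeoAction X').comp σ g⁻¹ (ι h) = ι h := hfix.subset ⟨h, rfl⟩ g⁻¹
  rw [← hι, ← hι]
  conv_rhs => rw [← h1]
  rw [MonoidHom.comp_apply, homeoAction_apply, ← map_inv, inv_inv]

omit [T2Space X] [LocallyCompactSpace X] in
/-- A nonnegative bump function, averaged over the group. -/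
theorem exists_averaged_bump [Finite G] (hι : ∀ f x, ι f x = f (π x))
    (hfix : Set.range ι = {a | ∀ g : G, (homeoAction X').comp σ g a = a}) {U : Set X'}
    (hU : IsOpen U) {y : X'} (hy : y ∈ U) :
    ∃ h : C₀(X, ℂ), h (π y) ≠ 0 ∧ ∀ z, h (π z) ≠ 0 → ∃ g : G, σ g z ∈ U := by
  have := Fintype.ofFinite G
  obtain ⟨b, r, hb, hr, hry, hr0⟩ := exists_bump_point hU hy
  set f : C₀(X', ℂ) := ∑ g, (homeoAction X').comp σ g b
  have hf : ∀ z, f z = ((∑ g, r (σ g⁻¹ z) : ℝ) : ℂ) := by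
    intro z
    rw [sum_apply, Complex.ofReal_sum]
    refine Finset.sum_congr rfl fun g _ => ?_
    rw [MonoidHom.comp_apply, homeoAction_apply, hb, ← map_inv]
  obtain ⟨h, hh⟩ : f ∈ Set.range ι := by
    rw [hfix]
    intro g
    simp only [f, map_sum]
    refine Fintype.sum_equiv (Equiv.mulLeft g) _ _ fun g' => ?_
    rw [Equiv.coe_mulLeft, map_mul]; rfl
  have hhf : ∀ z, h (π z) = f z := fun z => by rw [← hι, hh]
  refine ⟨h, ?_, fun z hz => ?_⟩
  · rw [hhf, hf]
    have : 0 < ∑ g, r (σ g⁻¹ y) :=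
      Finset.sum_pos' (fun g _ => (hr _).1) ⟨1, Finset.mem_univ _, by simp [hry]⟩
    exact_mod_cast this.ne'
  · rw [hhf, hf] at hz
    obtain ⟨g, -, hg⟩ := Finset.exists_ne_zero_of_sum_ne_zero (Complex.ofReal_ne_zero.1 hz)
    exact ⟨g⁻¹, by_contra fun hgU => hg (hr0 _ hgU)⟩

/-- If `y'` is not in the orbit of `y`, an averaged bump function at `y`, supported off the orbit of
`y'`, descends to a function on `X` separating `π y` from `π y'`. -/
theorem apply_eq_apply_iff_of_fixedPoints [Finite G] (hι : ∀ f x, ι f x = f (π x))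
    (hfix : Set.range ι = {a | ∀ g : G, (homeoAction X').comp σ g a = a}) (y y' : X') :
    π y = π y' ↔ ∃ g, σ g y = y' := by
  constructor
  · intro hyy
    by_contra! hne
    have hO : IsClosed (Set.range fun g => σ g y') := (Set.finite_range _).isClosed
    obtain ⟨h, h1, h2⟩ := exists_averaged_bump hι hfix hO.isOpen_compl (y := y) (by
      rintro ⟨g, hg⟩
      apply hne g⁻¹
      rw [← hg, map_inv]
      exact (σ g).symm_apply_apply y')
    rw [hyy] at h1
    obtain ⟨g, hg⟩ := h2 _ h1
    exact hg ⟨g, rfl⟩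
  · rintro ⟨g, rfl⟩
    exact (apply_eq_of_fixedPoints hι hfix g y).symm

omit [T2Space X] [LocallyCompactSpace X] in
-- The averaged bump function of a point of `U` descends to `X`, and the open set where it is
-- nonzero lies in the image of `U`.
theorem isOpenMap_of_fixedPoints [Finite G] (hsurj : Function.Surjective π)
    (hι : ∀ f x, ι f x = f (π x)) (hinv : ∀ (g : G) y, π (σ g y) = π y)
    (hfix : Set.range ι = {a | ∀ g : G, (homeoAction X').comp σ g a = a}) : IsOpenMap π := by
  intro U hU
  rw [isOpen_iff_mem_nhds]
  rintro _ ⟨y, hy, rfl⟩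
  obtain ⟨h, h1, h2⟩ := exists_averaged_bump hι hfix hU hy
  have hopen : IsOpen {x | h x ≠ 0} := isOpen_ne_fun h.continuous continuous_const
  refine mem_of_superset (hopen.mem_nhds h1) fun x hx => ?_
  obtain ⟨z, rfl⟩ := hsurj x
  obtain ⟨g, hg⟩ := h2 z hx
  exact ⟨_, hg, hinv g z⟩

/-- If points near `y` are fixed by the stabilizer of `y`, then the orbit map is injective
near `y`. -/
theorem exists_injOn_of_eventually_fixed {Y : Type*} [TopologicalSpace Y] [T2Space Y] [Finite G]
    {X : Type*} {π : Y → X} {σ : G →* (Y ≃ₜ Y)} (hfib : ∀ y y', π y = π y' → ∃ g, σ g y = y')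
    (y : Y) (hfix : ∀ᶠ z in 𝓝 y, ∀ h : G, σ h y = y → σ h z = z) :
    ∃ U ∈ 𝓝 y, Set.InjOn π U := by
  have hsep : ∀ g : G, ∃ V ∈ 𝓝 y, σ g y ≠ y → ∀ z ∈ V, σ g z ∉ V := by
    intro g
    by_cases hg : σ g y = y
    · exact ⟨Set.univ, univ_mem, fun h => absurd hg h⟩
    · obtain ⟨V, W, hV, hW, hyV, hyW, hVW⟩ := t2_separation hg
      refine ⟨W ∩ σ g ⁻¹' V, inter_mem (hW.mem_nhds hyW)
        ((σ g).continuous.continuousAt.preimage_mem_nhds (hV.mem_nhds hyV)), fun _ z hz hz' => ?_⟩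
      exact Set.disjoint_left.1 hVW hz.2 hz'.1
  choose V hV hVs using hsep
  -- If `z` and `σ g z` both lie in this set, then `g` cannot move `y`, by the choice of `V g`; so
  -- it fixes `y`, and therefore `z`.
  refine ⟨{z | ∀ h : G, σ h y = y → σ h z = z} ∩ ⋂ g, V g,
    inter_mem hfix (iInter_mem.2 hV), ?_⟩
  rintro z ⟨hz, hzV⟩ w ⟨-, hwV⟩ hzw
  obtain ⟨g, rfl⟩ := hfib _ _ hzw
  by_cases hg : σ g y = y
  · exact (hz g hg).symm
  · exact absurd (Set.mem_iInter.1 hwV g) (hVs g hg z (Set.mem_iInter.1 hzV g))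

theorem isLocalHomeomorph_of_locally_injOn {X Y : Type*} [TopologicalSpace X] [TopologicalSpace Y]
    {π : Y → X} (hπ : Continuous π) (ho : IsOpenMap π) (h : ∀ y, ∃ U ∈ 𝓝 y, Set.InjOn π U) :
    IsLocalHomeomorph π := by
  rw [isLocalHomeomorph_iff_isOpenEmbedding_restrict]
  intro y
  obtain ⟨U, hU, hinj⟩ := h y
  obtain ⟨V, hVU, hV, hyV⟩ := mem_nhds_iff.1 hU
  exact ⟨V, hV.mem_nhds hyV, .of_continuous_injective_isOpenMap
    (hπ.comp continuous_subtype_val) ((hinj.mono hVU).injective)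
    (ho.comp hV.isOpenMap_subtype_val)⟩

/-- A covering map whose fibres are the orbits of a group of homeomorphisms is regular. -/
theorem isRegular_of_orbits {X Y : Type*} [TopologicalSpace X] [TopologicalSpace Y]
    {π : Y → X} {σ : G →* (Y ≃ₜ Y)} (hc : IsCoveringMap π)
    (hfib : ∀ y y', π y = π y' ↔ ∃ g, σ g y = y') : IsRegular π := by
  intro ω hω
  by_cases hex : ∃ Γ : C(unitInterval, Y), (∀ t, π (Γ t) = ω t) ∧ Γ 0 = Γ 1
  · obtain ⟨Γ, hΓ, hcl⟩ := hex
    refine Or.inl fun Γ' hΓ' => ?_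
    obtain ⟨g, hg⟩ := (hfib (Γ 0) (Γ' 0)).1 (by rw [hΓ, hΓ'])
    have := hc.eq_of_comp_eq ((σ g).continuous.comp Γ.continuous) Γ'.continuous (by
      funext t
      simp only [Function.comp_apply]
      rw [hΓ', ← hΓ]
      exact ((hfib _ _).2 ⟨g, rfl⟩).symm) 0 hg
    rw [← this, Function.comp_apply, Function.comp_apply, hcl]
  · push Not at hex
    exact Or.inr hex

/-- A noncommutative finite-fold covering of commutative C*-algebras comes from a finite-fold
regular covering. -/
theorem IsNaturalFiniteFoldCovering.isFiniteFoldRegularCovering (hπ : Continuous π)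
    (hsurj : Function.Surjective π) {α : G →* (C₀(X', ℂ) ≃⋆ₐ[ℂ] C₀(X', ℂ))}
    (h : IsNaturalFiniteFoldCovering π α) : IsFiniteFoldRegularCovering π := by
  obtain ⟨σ, rfl⟩ := exists_homeoAction_comp α
  obtain ⟨ι, hι, hG, -, -, hfix, F, hF, -, hFJ⟩ := h
  have hfib := apply_eq_apply_iff_of_fixedPoints hι hfix
  have ho := isOpenMap_of_fixedPoints hsurj hι (apply_eq_of_fixedPoints hι hfix) hfix
  have hfin := finite_fiber_of_orbits hsurj hfib
  have hloc : ∀ y, ∃ U ∈ 𝓝 y, Set.InjOn π U := by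
    intro y
    refine exists_injOn_of_eventually_fixed (fun y y' => (hfib y y').1) y ?_
    obtain ⟨b, r, hb, -, hr, -⟩ := exists_bump_point isOpen_univ (Set.mem_univ y)
    -- Since `b y = 1`, an element at distance less than `1` from `b` does not vanish at `y`.
    obtain ⟨a, ha, hab⟩ := Metric.dense_iff.1 hF b 1 one_pos
    obtain ⟨J, hJF, hab⟩ := Set.mem_iUnion₂.1 hab
    have hay : a y ≠ 0 := by
      intro h0
      have h1 := norm_apply_le (a - b) y
      rw [ZeroAtInftyContinuousMap.sub_apply, h0, hb, hr] at h1
      rw [Metric.mem_ball, dist_eq_norm] at ha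
      norm_num at h1
      linarith
    obtain ⟨hJ, B, B', _, _, i, β, j, j', -, -, hj', -, -, hess, -, hcov, heq⟩ := hFJ J hJF
    let H : Subgroup G :=
      { carrier := {g | σ g y = y}
        mul_mem' := fun {g g'} hg hg' => by
          simp only [Set.mem_ofPred_eq] at hg hg' ⊢
          rw [map_mul, Homeomorph.mul_apply, hg', hg]
        one_mem' := by simp
        inv_mem' := fun {g} hg => by
          simp only [Set.mem_ofPred_eq] at hg ⊢
          rw [map_inv]
          conv_lhs => rw [← hg]
          exact (σ g).symm_apply_apply y }
    have := Fintype.ofFinite H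
    obtain ⟨n, E, v, a', ha', hv, hgen⟩ := exists_generators σ J hJ hj' hess hcov heq hab hay
      (fun h : H => (h : G))
    exact eventually_fixed_of_generators σ y H (fun h hh => hh) E v a' ha' hv hgen
  have hlh := isLocalHomeomorph_of_locally_injOn hπ ho hloc
  have hc : IsCoveringMap π := by
    rw [isCoveringMap_iff_isCoveringMapOn_univ]
    exact (isClosedMap_of_orbits hπ hsurj ho hfib).isCoveringMapOn_of_isLocalHomeomorphOn
      (fun x _ => hfin x) (fun y _ => hlh y)
  exact ⟨hc, hfin, isRegular_of_orbits hc hfib⟩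

end Covering

end NCCovering

/-! ### Unital coverings from finite group actions on compact spaces -/

namespace NCCovering

open Topology Filter

/-- A dual basis of `B'` with respect to a `B`-valued form shows that `B'` is a finitely generated
projective module. -/
theorem finite_and_projective_of_dual_basis {B B' : Type*} [CStarAlgebra B] [CStarAlgebra B']
    {i : B →⋆ₐ[ℂ] B'} {κ : Type*} [Fintype κ] (e e' : κ → B') (E : B' → B)
    (hadd : ∀ a b, E (a + b) = E a + E b) (hmul : ∀ a b, E (a * i b) = E a * b)
    (h : ∀ a, ∑ k, e' k * i (E (e k * a)) = a) :
    Module.Finite Bᵐᵒᵖ (RightModule i) ∧ Module.Projective Bᵐᵒᵖ (RightModule i) := by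
  let S : RightModule i →ₗ[Bᵐᵒᵖ] (κ → Bᵐᵒᵖ) :=
    { toFun := fun a k => MulOpposite.op (E (e k * (show B' from a)))
      map_add' := fun a b => by
        funext k
        change MulOpposite.op (E (e k * ((show B' from a) + (show B' from b)))) = _
        rw [mul_add, hadd]; rfl
      map_smul' := fun c a => by
        funext k
        change MulOpposite.op (E (e k * ((show B' from a) * i c.unop))) = _
        rw [← mul_assoc, hmul]; rfl }
  let P : (κ → Bᵐᵒᵖ) →ₗ[Bᵐᵒᵖ] RightModule i :=
    Fintype.linearCombination Bᵐᵒᵖ (M := RightModule i) e'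
  have hPS : P.comp S = LinearMap.id := by
    ext a
    exact h a
  exact ⟨Module.Finite.of_surjective P fun a => ⟨S a, LinearMap.congr_fun hPS a⟩,
    Module.Projective.of_split S P hPS⟩

section Compact

variable {K K' G : Type*} [TopologicalSpace K] [CompactSpace K] [T2Space K]
  [TopologicalSpace K'] [CompactSpace K'] [T2Space K'] [Group G]

/-- The action of the group of homeomorphisms of `K` on `C(K)`. -/
noncomputable def compactAction (K : Type*) [TopologicalSpace K] [CompactSpace K] :
    (K ≃ₜ K) →* (C(K, ℂ) ≃⋆ₐ[ℂ] C(K, ℂ)) where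
  toFun g := g.symm.compStarAlgEquiv' ℂ ℂ
  map_one' := rfl
  map_mul' _ _ := rfl

variable [Finite G] {σ : G →* (K' ≃ₜ K')}

/-- A finite group acting faithfully on a compact space with locally injective orbit map gives a
unital noncommutative finite-fold covering. -/
theorem isUnitalFiniteFoldCovering_of_orbits (p : C(K', K)) (hsurj : Function.Surjective p)
    (hσ : Function.Injective σ) (hfib : ∀ y y', p y = p y' ↔ ∃ g, σ g y = y')
    (hloc : ∀ y, ∃ U ∈ 𝓝 y, Set.InjOn p U) :
    IsUnitalFiniteFoldCovering (p.compStarAlgHom' ℂ ℂ) ((compactAction K').comp σ) := by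
  have := Fintype.ofFinite G
  have hi : Function.Injective (p.compStarAlgHom' ℂ ℂ) := by
    intro f f' h
    ext x
    obtain ⟨y, rfl⟩ := hsurj x
    exact DFunLike.congr_fun h y
  have hq : IsQuotientMap p := p.continuous.isClosedMap.isQuotientMap p.continuous hsurj
  have hβ : ∀ g (f : C(K', ℂ)) y, (compactAction K').comp σ g f y = f (σ g⁻¹ y) := by
    intro g f y
    rw [map_inv]; rfl
  have hpσ : ∀ g y, p (σ g y) = p y := fun g y => ((hfib _ _).2 ⟨g, rfl⟩).symm
  have hfix : ∀ f : C(K', ℂ), (∀ g y, f (σ g⁻¹ y) = f y) → ∃ h : C(K, ℂ),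
      p.compStarAlgHom' ℂ ℂ h = f := by
    intro f hf
    refine ⟨⟨fun x => f (hsurj x).choose, ?_⟩, ?_⟩
    · rw [hq.continuous_iff]
      convert f.continuous using 1
      funext y
      obtain ⟨g, hg⟩ := (hfib y _).1 (hsurj (p y)).choose_spec.symm
      simp only [Function.comp_apply]
      rw [← hg, ← hf g⁻¹ y, inv_inv]
    · ext y
      obtain ⟨g, hg⟩ := (hfib y _).1 (hsurj (p y)).choose_spec.symm
      change f (hsurj (p y)).choose = f y
      rw [← hg, ← hf g⁻¹ y, inv_inv]
  -- the `B`-valued average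
  have hE : ∀ f : C(K', ℂ), ∃ h : C(K, ℂ), ∀ y, h (p y) = ∑ g, f (σ g⁻¹ y) := by
    intro f
    have hcont : Continuous fun y => ∑ g, f (σ g⁻¹ y) :=
      continuous_finsetSum _ fun g _ => f.continuous.comp (σ g⁻¹).continuous
    obtain ⟨h, hh⟩ := hfix ⟨_, hcont⟩ fun g y => by
      refine Fintype.sum_equiv (Equiv.mulLeft g) _ _ fun g' => ?_
      simp [mul_inv_rev, map_mul, Homeomorph.mul_apply]
    exact ⟨h, fun y => DFunLike.congr_fun hh y⟩
  choose E hE using hE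
  have hEadd : ∀ a b, E (a + b) = E a + E b := by
    intro a b
    ext x
    obtain ⟨y, rfl⟩ := hsurj x
    simp only [hE, ContinuousMap.add_apply, Finset.sum_add_distrib]
  have hEmul : ∀ a b, E (a * p.compStarAlgHom' ℂ ℂ b) = E a * b := by
    intro a b
    ext x
    obtain ⟨y, rfl⟩ := hsurj x
    rw [hE, ContinuousMap.mul_apply, hE, Finset.sum_mul]
    refine Finset.sum_congr rfl fun g _ => ?_
    rw [ContinuousMap.mul_apply, ContinuousMap.compStarAlgHom'_apply, ContinuousMap.comp_apply,
      hpσ]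
  -- bump functions with small support
  have hbump : ∀ y : K', ∃ r : C(K', ℝ), (∀ z, 0 ≤ r z) ∧ r y ≠ 0 ∧
      ∀ z w, p z = p w → r z * r w ≠ 0 → z = w := by
    intro y
    obtain ⟨U, hU, hinj⟩ := hloc y
    obtain ⟨V, hVU, hV, hyV⟩ := mem_nhds_iff.1 hU
    obtain ⟨r, h1, -, h3, h4⟩ := exists_continuousMap_one_of_isCompact_subset_isOpen
      isCompact_singleton hV (Set.singleton_subset_iff.2 hyV)
    have h5 : ∀ z, r z ≠ 0 → z ∈ U := fun z hz => hVU (h3 (subset_tsupport r hz))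
    refine ⟨r, fun z => (h4 z).1, by simp [h1 rfl], fun z w hzw hne => ?_⟩
    exact hinj (h5 z (left_ne_zero_of_mul hne)) (h5 w (right_ne_zero_of_mul hne)) hzw
  choose r hr0 hry hrinj using hbump
  obtain ⟨t, -, ht⟩ := isCompact_univ.elim_nhds_subcover (fun y => {z | r y z ≠ 0}) fun y _ =>
    (isOpen_ne_fun (r y).continuous continuous_const).mem_nhds (hry y)
  -- Stabilizers may be nontrivial, so the normalizing factor keeps the sum over all `g` and not
  -- only the squares `r k z ^ 2`; the term `g = 1` makes it positive.
  set s : K' → ℝ := fun z => ∑ k : t, ∑ g, r k z * r k (σ g⁻¹ z)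
  have hs : ∀ z, 0 < s z := by
    intro z
    obtain ⟨y, hy, hyz⟩ := Set.mem_iUnion₂.1 (ht (Set.mem_univ z))
    have hnn : ∀ (k : t) g, 0 ≤ r k z * r k (σ g⁻¹ z) := fun k g => mul_nonneg (hr0 _ _) (hr0 _ _)
    refine Finset.sum_pos' (fun k _ => Finset.sum_nonneg fun g _ => hnn k g)
      ⟨⟨y, hy⟩, Finset.mem_univ _, ?_⟩
    refine Finset.sum_pos' (fun g _ => hnn _ g) ⟨1, Finset.mem_univ _, ?_⟩
    have : 0 < r y z := lt_of_le_of_ne (hr0 _ _) (Ne.symm hyz)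
    simp only [inv_one, map_one, Homeomorph.one_apply]
    exact mul_pos this this
  have hscont : Continuous s := by
    refine continuous_finsetSum _ fun k _ => continuous_finsetSum _ fun g _ => ?_
    exact (r k).continuous.mul ((r k).continuous.comp (σ g⁻¹).continuous)
  let e : t → C(K', ℂ) := fun k => ⟨fun z => (r k z : ℂ),
    Complex.continuous_ofReal.comp (r k).continuous⟩
  let e' : t → C(K', ℂ) := fun k => ⟨fun z => (r k z : ℂ) / (s z : ℂ),
    (Complex.continuous_ofReal.comp (r k).continuous).div
      (Complex.continuous_ofReal.comp hscont) fun z => by exact_mod_cast (hs z).ne'⟩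
  have hdual : ∀ a : C(K', ℂ), ∑ k, e' k * p.compStarAlgHom' ℂ ℂ (E (e k * a)) = a := by
    intro a
    ext z
    -- A nonzero product forces `σ g⁻¹ z = z`, because `p` is injective where `r k` is nonzero.
    have hterm : ∀ (k : t) g, (r k z : ℂ) * (r k (σ g⁻¹ z) * a (σ g⁻¹ z)) =
        (r k z : ℂ) * r k (σ g⁻¹ z) * a z := by
      intro k g
      by_cases hne : r k z * r k (σ g⁻¹ z) = 0
      · have : (r k z : ℂ) * r k (σ g⁻¹ z) = 0 := by exact_mod_cast hne
        rw [← mul_assoc, this, zero_mul, zero_mul]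
      · rw [← hrinj k z _ (hpσ _ _).symm hne, mul_assoc]
    have h1 : ∀ k : t, (e' k * p.compStarAlgHom' ℂ ℂ (E (e k * a))) z =
        (∑ g, (r k z : ℂ) * r k (σ g⁻¹ z)) * a z / s z := by
      intro k
      rw [ContinuousMap.mul_apply, ContinuousMap.compStarAlgHom'_apply, ContinuousMap.comp_apply,
        hE, Finset.sum_mul, ← Finset.sum_congr rfl fun g _ => hterm k g, ← Finset.mul_sum]
      simp only [e', e, ContinuousMap.coe_mk, ContinuousMap.mul_apply]
      ring
    rw [ContinuousMap.sum_apply, Finset.sum_congr rfl fun k _ => h1 k, ← Finset.sum_div,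
      ← Finset.sum_mul]
    have h2 : ∑ k : t, ∑ g, (r k z : ℂ) * r k (σ g⁻¹ z) = (s z : ℂ) := by
      simp [s]
    rw [h2, mul_comm, mul_div_assoc, div_self (by exact_mod_cast (hs z).ne'), mul_one]
  obtain ⟨hfin, hproj⟩ := finite_and_projective_of_dual_basis e e' E hEadd hEmul hdual
  refine ⟨inferInstance, hi, fun g g' hgg => hσ ?_, Set.Subset.antisymm ?_ ?_, hfin, hproj⟩
  · rw [← inv_inj]
    ext y
    refine eq_of_forall_apply_eq fun f => ?_
    exact DFunLike.congr_fun (DFunLike.congr_fun hgg f.toContinuousMap) y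
  · rintro _ ⟨f, rfl⟩ g
    ext y
    rw [hβ, ContinuousMap.compStarAlgHom'_apply, ContinuousMap.comp_apply,
      ContinuousMap.comp_apply, hpσ]
  · intro f hf
    obtain ⟨h, hh⟩ := hfix f fun g y => by rw [← hβ, hf g]
    exact ⟨h, hh⟩

end Compact

/-! ### Ideals of functions vanishing off an open set -/

section Ideals

variable {Y : Type*} [TopologicalSpace Y]

/-- The closed ideal of functions which vanish off `U`. -/
def vanishingIdeal (U : Set Y) : ClosedIdeal C₀(Y, ℂ) where
  carrier := {f | ∀ y ∉ U, f y = 0}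
  add_mem' {f g} hf hg y hy := by
    rw [ZeroAtInftyContinuousMap.add_apply, hf y hy, hg y hy, add_zero]
  zero_mem' _ _ := rfl
  mul_mem' {f g} hf _ y hy := by
    rw [ZeroAtInftyContinuousMap.mul_apply, hf y hy, zero_mul]
  smul_mem' c f hf y hy := by
    rw [ZeroAtInftyContinuousMap.smul_apply, hf y hy, smul_zero]
  star_mem' {f} hf y hy := by
    change star f y = 0
    rw [ZeroAtInftyContinuousMap.star_apply, hf y hy, star_zero]
  ideal_left f g hg y hy := by
    rw [ZeroAtInftyContinuousMap.mul_apply, hg y hy, mul_zero]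
  ideal_right f g hg y hy := by
    rw [ZeroAtInftyContinuousMap.mul_apply, hg y hy, zero_mul]
  isClosed := by
    have : {f : C₀(Y, ℂ) | ∀ y ∉ U, f y = 0} = ⋂ y ∈ Uᶜ, {f | f y = 0} := by
      ext f; simp
    change IsClosed {f : C₀(Y, ℂ) | ∀ y ∉ U, f y = 0}
    rw [this]
    refine isClosed_biInter fun y _ => isClosed_eq ?_ continuous_const
    exact starAlgHom_continuous (evalHom y)

/-- Restriction of functions to a compact set. -/
noncomputable def restrictHom (K : Set Y) [CompactSpace K] : C₀(Y, ℂ) →⋆ₙₐ[ℂ] C(K, ℂ) where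
  toFun f := ⟨fun y => f y, f.continuous.comp continuous_subtype_val⟩
  map_smul' _ _ := rfl
  map_zero' := rfl
  map_add' _ _ := rfl
  map_mul' _ _ := rfl
  map_star' _ := rfl

/-- Restriction of the elements of an ideal to a compact set. -/
noncomputable def ClosedIdeal.restrictHom (J : ClosedIdeal C₀(Y, ℂ)) (K : Set Y) [CompactSpace K] :
    J.toNonUnitalStarSubalgebra →⋆ₙₐ[ℂ] C(K, ℂ) :=
  (NCCovering.restrictHom K).comp
    (NonUnitalStarSubalgebraClass.subtype J.toNonUnitalStarSubalgebra)

theorem ClosedIdeal.restrictHom_apply (J : ClosedIdeal C₀(Y, ℂ)) (K : Set Y) [CompactSpace K]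
    (f : J.toNonUnitalStarSubalgebra) (y : K) : J.restrictHom K f y = f.1 y := rfl

variable {J : ClosedIdeal C₀(Y, ℂ)} {U K : Set Y} [CompactSpace K]

theorem ClosedIdeal.restrictHom_injective (hJ : ∀ f, f ∈ J.carrier → ∀ y ∉ U, f y = 0)
    (hUK : U ⊆ K) : Function.Injective (J.restrictHom K) := by
  intro f f' h
  refine Subtype.ext ?_
  ext y
  by_cases hy : y ∈ U
  · exact DFunLike.congr_fun h ⟨y, hUK hy⟩
  · rw [hJ _ f.2 y hy, hJ _ f'.2 y hy]

/-- Extension by zero inverts restriction. This description of the range gives both the ideal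
property and `A = B ∩ A'`. -/
theorem ClosedIdeal.mem_range_restrictHom [T2Space Y] (hJ : ∀ f, f ∈ J.carrier ↔ ∀ y ∉ U, f y = 0)
    (hU : IsOpen U) (hUK : U ⊆ K) (f : C(K, ℂ)) :
    f ∈ Set.range (J.restrictHom K) ↔ ∀ y : K, (y : Y) ∉ U → f y = 0 := by
  constructor
  · rintro ⟨a, rfl⟩ y hy
    exact (hJ _).1 a.2 y hy
  · intro hf
    obtain ⟨F, hF, hF0⟩ := exists_extension_by_zero (isCompact_iff_compactSpace.2 ‹_›) hU hUK f hf
    exact ⟨⟨F, (hJ F).2 hF0⟩, ContinuousMap.ext hF⟩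

/-- The functions vanishing off a dense open subset of a compact set form an essential ideal. -/
theorem ClosedIdeal.hasEssentialIdealRange_restrictHom [T2Space Y] [LocallyCompactSpace Y]
    (hJ : ∀ f, f ∈ J.carrier ↔ ∀ y ∉ U, f y = 0) (hU : IsOpen U) (hUK : U ⊆ K)
    (hKU : K ⊆ closure U) : HasEssentialIdealRange (J.restrictHom K) where
  mul_mem_left b a := by
    rw [ClosedIdeal.mem_range_restrictHom hJ hU hUK]
    intro y hy
    rw [ContinuousMap.mul_apply, ClosedIdeal.restrictHom_apply, (hJ _).1 a.2 y hy, mul_zero]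
  mul_mem_right b a := by
    rw [ClosedIdeal.mem_range_restrictHom hJ hU hUK]
    intro y hy
    rw [ContinuousMap.mul_apply, ClosedIdeal.restrictHom_apply, (hJ _).1 a.2 y hy, zero_mul]
  essential b hb := by
    have hdense : Dense ((↑) ⁻¹' U : Set K) := by
      intro y
      rw [closure_subtype, Subtype.image_preimage_coe, Set.inter_eq_right.2 hUK]
      exact hKU y.2
    have h0 : ∀ y ∈ ((↑) ⁻¹' U : Set K), b y = 0 := by
      intro y hy
      obtain ⟨f, r, hf, -, hr, hr0⟩ := exists_bump_point hU hy
      have := DFunLike.congr_fun (hb ⟨f, (hJ f).2 fun z hz => by simp [hf, hr0 z hz]⟩) y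
      rw [ContinuousMap.mul_apply, ClosedIdeal.restrictHom_apply] at this
      simpa [hf, hr] using this
    refine DFunLike.coe_injective ?_
    exact Continuous.ext_on hdense b.continuous continuous_const h0

end Ideals

end NCCovering

/-! ### Regular coverings are noncommutative coverings -/

namespace NCCovering

open Topology Filter

section Converse

variable {X X' G : Type*} [TopologicalSpace X] [T2Space X] [LocallyCompactSpace X]
  [TopologicalSpace X'] [T2Space X'] [LocallyCompactSpace X'] [Group G]
  {π : X' → X} {σ : G →* (X' ≃ₜ X')} {ι : C₀(X, ℂ) →⋆ₙₐ[ℂ] C₀(X', ℂ)}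

/-- The *-homomorphism `C₀(X) → C₀(X')` induced by a proper map. -/
noncomputable def pullback (hπ : IsProperMap π) : C₀(X, ℂ) →⋆ₙₐ[ℂ] C₀(X', ℂ) :=
  let p : CocompactMap X' X := ⟨⟨π, hπ.continuous⟩,
    (isProperMap_iff_tendsto_cocompact.1 hπ).2⟩
  { toFun := fun f => f.comp p
    map_smul' := fun _ _ => rfl
    map_zero' := rfl
    map_add' := fun _ _ => rfl
    map_mul' := fun _ _ => rfl
    map_star' := fun _ => rfl }

omit [T2Space X'] [LocallyCompactSpace X'] in
theorem pullback_apply (hπ : IsProperMap π) (f : C₀(X, ℂ)) (y : X') :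
    pullback hπ f y = f (π y) := rfl

/-- The restriction of an action by homeomorphisms to an invariant subset. -/
def restrictHomeo {Y : Type*} [TopologicalSpace Y] (σ : G →* (Y ≃ₜ Y)) (K : Set Y)
    (hK : ∀ g y, y ∈ K ↔ σ g y ∈ K) : G →* (K ≃ₜ K) where
  toFun g := (σ g).subtype (hK g)
  map_one' := by ext y; simp
  map_mul' g g' := by ext y; simp [Homeomorph.mul_apply]

omit [TopologicalSpace X] [T2Space X] [LocallyCompactSpace X] [T2Space X']
  [LocallyCompactSpace X'] in
theorem image_vanishingIdeal (hinv : ∀ g y, π (σ g y) = π y) (U : Set X) (g : G) :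
    (homeoAction X').comp σ g '' (vanishingIdeal (π ⁻¹' U)).carrier =
      (vanishingIdeal (π ⁻¹' U)).carrier := by
  have hsub : ∀ (g : G) f, f ∈ (vanishingIdeal (π ⁻¹' U)).carrier →
      (homeoAction X').comp σ g f ∈ (vanishingIdeal (π ⁻¹' U)).carrier := by
    intro g f hf y hy
    rw [MonoidHom.comp_apply, homeoAction_apply, ← map_inv]
    refine hf _ fun h => hy ?_
    rwa [Set.mem_preimage, hinv] at h
  refine Set.Subset.antisymm ?_ fun f hf => ⟨(homeoAction X').comp σ g⁻¹ f, hsub _ _ hf, ?_⟩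
  · rintro _ ⟨f, hf, rfl⟩
    exact hsub g f hf
  · rw [← StarAlgEquiv.mul_apply, ← map_mul, mul_inv_cancel, map_one]; rfl

/-- The functions vanishing off the preimage of a relatively compact open set form a
noncommutative covering with compactification. -/
theorem isFiniteFoldCoveringWithCompactification_vanishingIdeal [Finite G]
    (hπ : IsProperMap π) (hsurj : Function.Surjective π) (ho : IsOpenMap π)
    (hfib : ∀ y y', π y = π y' ↔ ∃ g, σ g y = y') (hloc : ∀ y, ∃ U ∈ 𝓝 y, Set.InjOn π U)
    (hfree : ∀ x g, (∀ y, π y = x → σ g y = y) → g = 1)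
    (hι : ∀ f x, ι f x = f (π x)) {U : Set X} (hU : IsOpen U) (hne : U.Nonempty)
    (hUc : IsCompact (closure U))
    (hJ : ∀ g : G, (homeoAction X').comp σ g '' (vanishingIdeal (π ⁻¹' U)).carrier =
      (vanishingIdeal (π ⁻¹' U)).carrier) :
    IsFiniteFoldCoveringWithCompactification ((vanishingIdeal (π ⁻¹' U)).inclusion ι)
      ((vanishingIdeal (π ⁻¹' U)).restrictAction ((homeoAction X').comp σ) hJ) := by
  have hcont := hπ.continuous
  have hinv : ∀ g y, π (σ g y) = π y := fun g y => ((hfib _ _).2 ⟨g, rfl⟩).symm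
  set J := vanishingIdeal (π ⁻¹' U)
  set K := closure U
  set K' := π ⁻¹' K
  have hK : CompactSpace K := isCompact_iff_compactSpace.1 hUc
  have hK' : CompactSpace K' := isCompact_iff_compactSpace.1 (hπ.isCompact_preimage hUc)
  let p : C(K', K) := ⟨K.restrictPreimage π, hcont.restrictPreimage⟩
  have hp : ∀ y, (p y : X) = π y := fun _ => rfl
  have hpsurj : Function.Surjective p := K.restrictPreimage_surjective hsurj
  let τ := restrictHomeo σ K' fun g y => by simp only [K', Set.mem_preimage, hinv]
  have hτ : ∀ g y, (τ g y : X') = σ g y := fun _ _ => rfl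
  have hUK : U ⊆ K := subset_closure
  have hU' : IsOpen (π ⁻¹' U) := hU.preimage hcont
  have hUK' : π ⁻¹' U ⊆ K' := Set.preimage_mono hUK
  -- Openness of `π` makes `π ⁻¹' U` dense in `K'`, as essentiality of the ideal upstairs requires.
  have hKU' : K' ⊆ closure (π ⁻¹' U) := ho.preimage_closure_subset_closure_preimage
  have hmem' : ∀ f, f ∈ J.carrier ↔ ∀ y ∉ π ⁻¹' U, f y = 0 := fun f => Iff.rfl
  have hmem : ∀ f, f ∈ (J.comap ι).carrier ↔ ∀ x ∉ U, f x = 0 := by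
    intro f
    change (∀ y ∉ π ⁻¹' U, ι f y = 0) ↔ _
    simp_rw [hι]
    constructor
    · intro h x hx
      obtain ⟨y, rfl⟩ := hsurj x
      exact h y hx
    · exact fun h y hy => h _ hy
  have hιinj : Function.Injective (J.inclusion ι) := by
    intro f f' h
    refine Subtype.ext ?_
    ext x
    obtain ⟨y, rfl⟩ := hsurj x
    rw [← hι, ← hι]
    exact DFunLike.congr_fun (congr_arg Subtype.val h) y
  have hcomp : ∀ a, p.compStarAlgHom' ℂ ℂ ((J.comap ι).restrictHom K a) =
      J.restrictHom K' (J.inclusion ι a) := by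
    intro a
    ext y
    exact (hι a.1 y).symm
  refine ⟨C(K, ℂ), C(K', ℂ), inferInstance, inferInstance, p.compStarAlgHom' ℂ ℂ,
    (compactAction K').comp τ, (J.comap ι).restrictHom K, J.restrictHom K', hιinj,
    ClosedIdeal.restrictHom_injective (fun f => (hmem f).1) hUK,
    ClosedIdeal.restrictHom_injective (fun f => (hmem' f).1) hUK', hcomp,
    ClosedIdeal.hasEssentialIdealRange_restrictHom hmem hU hUK subset_rfl,
    ClosedIdeal.hasEssentialIdealRange_restrictHom hmem' hU' hUK' hKU', ?_, ?_, ?_⟩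
  · refine Set.Subset.antisymm ?_ ?_
    · rintro _ ⟨a, rfl⟩
      exact ⟨⟨_, rfl⟩, ⟨_, (hcomp a).symm⟩⟩
    · rintro _ ⟨⟨b, rfl⟩, hb⟩
      rw [ClosedIdeal.mem_range_restrictHom hmem' hU' hUK'] at hb
      obtain ⟨a, ha⟩ := (ClosedIdeal.mem_range_restrictHom hmem hU hUK b).2 fun x hx => by
        obtain ⟨y, rfl⟩ := hpsurj x
        exact hb y hx
      exact ⟨a, congr_arg _ ha⟩
  · refine isUnitalFiniteFoldCovering_of_orbits p hpsurj ?_ ?_ ?_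
    · rw [injective_iff_map_eq_one]
      intro g hg
      -- `K'` must contain a whole fibre for the restricted action to be faithful; hence only
      -- nonempty `U` are used.
      obtain ⟨x, hx⟩ := hne
      refine hfree x g fun y hy => ?_
      have hyK : y ∈ K' := by
        rw [Set.mem_preimage, hy]; exact hUK hx
      rw [← hτ g ⟨y, hyK⟩, hg]; rfl
    · intro y y'
      rw [Subtype.ext_iff, hp, hp, hfib]
      simp_rw [Subtype.ext_iff, hτ]
    · intro y
      obtain ⟨V, hV, hinj⟩ := hloc y
      exact ⟨(↑) ⁻¹' V, continuous_subtype_val.continuousAt.preimage_mem_nhds hV,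
        fun z hz w hw hzw => Subtype.ext (hinj hz hw
          ((hp z).symm.trans ((congr_arg Subtype.val hzw).trans (hp w))))⟩
  · intro g a
    rfl

/-- A finite group acting by homeomorphisms with locally injective orbit map, faithfully on each
orbit, gives a noncommutative finite-fold covering. -/
theorem isNaturalFiniteFoldCovering_of_orbits [Finite G] [Nonempty X] (hcont : Continuous π)
    (hsurj : Function.Surjective π) (ho : IsOpenMap π)
    (hfib : ∀ y y', π y = π y' ↔ ∃ g, σ g y = y') (hloc : ∀ y, ∃ U ∈ 𝓝 y, Set.InjOn π U)
    (hfree : ∀ x g, (∀ y, π y = x → σ g y = y) → g = 1) :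
    IsNaturalFiniteFoldCovering π ((homeoAction X').comp σ) := by
  have hπ := isProperMap_of_orbits hcont hsurj ho hfib
  have hinv : ∀ g y, π (σ g y) = π y := fun g y => ((hfib _ _).2 ⟨g, rfl⟩).symm
  obtain ⟨x₀⟩ := (inferInstance : Nonempty X)
  have hσ : Function.Injective σ := by
    rw [injective_iff_map_eq_one]
    intro g hg
    exact hfree x₀ g fun y _ => by rw [hg]; rfl
  -- every compact set is contained in a nonempty relatively compact open set
  have hopen : ∀ S : Set X, IsCompact S → ∃ U : Set X, IsOpen U ∧ U.Nonempty ∧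
      IsCompact (closure U) ∧ S ⊆ U := by
    intro S hS
    obtain ⟨L, hL, hSL⟩ := exists_compact_superset (hS.union (isCompact_singleton (x := x₀)))
    exact ⟨interior L, isOpen_interior, ⟨x₀, hSL (Or.inr rfl)⟩,
      hL.of_isClosed_subset isClosed_closure (hL.isClosed.closure_subset_iff.2 interior_subset),
      fun x hx => hSL (Or.inl hx)⟩
  refine ⟨pullback hπ, pullback_apply hπ, inferInstance, ?_, homeoAction_bijective.1.comp hσ,
    Set.Subset.antisymm ?_ ?_, {J | ∃ U : Set X, IsOpen U ∧ U.Nonempty ∧ IsCompact (closure U) ∧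
      J = vanishingIdeal (π ⁻¹' U)}, ?_, ?_, ?_⟩
  · intro f f' h
    ext x
    obtain ⟨y, rfl⟩ := hsurj x
    exact DFunLike.congr_fun h y
  · rintro _ ⟨f, rfl⟩ g
    ext y
    rw [MonoidHom.comp_apply, homeoAction_apply, ← map_inv, pullback_apply, pullback_apply, hinv]
  · intro f hf
    obtain ⟨h, hh⟩ := exists_comp_eq hcont hsurj ho f fun y y' hyy => by
      obtain ⟨g, rfl⟩ := (hfib y y').1 hyy
      have := DFunLike.congr_fun (hf g⁻¹) y
      rw [MonoidHom.comp_apply, homeoAction_apply, ← map_inv, inv_inv] at this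
      exact this.symm
    exact ⟨h, by ext y; exact (hh y).symm⟩
  · rw [Metric.dense_iff]
    intro f ε hε
    obtain ⟨f', S, hS, hf', hff'⟩ := exists_isCompact_approx f (half_pos hε)
    obtain ⟨U, hU, hne, hUc, hSU⟩ := hopen _ (hS.image hcont)
    refine ⟨f', by rw [Metric.mem_ball, dist_eq_norm]; linarith,
      Set.mem_iUnion₂.2 ⟨_, ⟨U, hU, hne, hUc, rfl⟩, fun y hy => hf' y fun hyS => hy ?_⟩⟩
    exact hSU ⟨y, hyS, rfl⟩
  · rw [Metric.dense_iff]
    intro f ε hε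
    obtain ⟨f', S, hS, hf', hff'⟩ := exists_isCompact_approx f (half_pos hε)
    obtain ⟨U, hU, hne, hUc, hSU⟩ := hopen _ hS
    refine ⟨f', by rw [Metric.mem_ball, dist_eq_norm]; linarith,
      Set.mem_iUnion₂.2 ⟨_, ⟨U, hU, hne, hUc, rfl⟩, fun y hy => hf' _ fun hyS => hy (hSU hyS)⟩⟩
  · rintro _ ⟨U, hU, hne, hUc, rfl⟩
    exact ⟨image_vanishingIdeal hinv U, isFiniteFoldCoveringWithCompactification_vanishingIdeal hπ
      hsurj ho hfib hloc hfree (pullback_apply hπ) hU hne hUc _⟩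

/-- A finite-fold regular covering of a connected, locally path-connected space gives a
noncommutative finite-fold covering, for every group isomorphic to the group of covering
transformations. -/
theorem IsFiniteFoldRegularCovering.isNaturalFiniteFoldCovering [PathConnectedSpace X]
    [LocallyPathConnectedSpace X] (h : IsFiniteFoldRegularCovering π)
    (hsurj : Function.Surjective π) (e : G ≃* deckGroup π) :
    IsNaturalFiniteFoldCovering π ((deckAction π).comp (e : G →* deckGroup π)) := by
  have hc := h.isCoveringMap
  have hdeck := h.finite_deckGroup
  have hG : Finite G := Finite.of_equiv _ e.symm.toEquiv
  refine isNaturalFiniteFoldCovering_of_orbits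
    (σ := (deckGroup π).subtype.comp (e : G →* deckGroup π)) hc.continuous hsurj hc.isOpenMap
    (fun y y' => ⟨fun hyy => ?_, ?_⟩) (fun y => ?_) (fun x g hg => ?_)
  · obtain ⟨g, hg, hgy⟩ := h.exists_deckGroup_apply_eq hyy
    exact ⟨e.symm ⟨g, hg⟩, by simpa using hgy⟩
  · rintro ⟨g, rfl⟩
    exact ((e g).2 y).symm
  · obtain ⟨U, hU, hyU, hinj⟩ := hc.isLocalHomeomorph.isLocallyInjective y
    exact ⟨U, hU.mem_nhds hyU, hinj⟩
  -- `X'` may be disconnected, so a nontrivial covering transformation can have fixed points; it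
  -- cannot fix a whole fibre.
  · have := eq_of_eqOn_fiber hc (e g).2 (deckGroup π).one_mem x hg
    exact (map_eq_one_iff e e.injective).1 (Subtype.ext this)

end Converse

end NCCovering

open NCCovering in
theorem theorem4p3 {X : Type*} {X' : Type*} [TopologicalSpace X] [T2Space X]
    [LocallyCompactSpace X] [TopologicalSpace X'] [T2Space X'] [LocallyCompactSpace X']
    (π : X' → X) (hπ : Continuous π) (hsurj : Function.Surjective π) :
    (∀ (G : Type*) [Group G] (α : G →* (C₀(X', ℂ) ≃⋆ₐ[ℂ] C₀(X', ℂ))),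
      IsNaturalFiniteFoldCovering π α → IsFiniteFoldRegularCovering π) ∧
    (ConnectedSpace X → LocallyPathConnectedSpace X →
      (IsFiniteFoldRegularCovering π ↔
        ∃ (G : Type) (_ : Group G) (α : G →* (C₀(X', ℂ) ≃⋆ₐ[ℂ] C₀(X', ℂ))),
          IsNaturalFiniteFoldCovering π α) ∧
      (IsFiniteFoldRegularCovering π ↔ IsNaturalFiniteFoldCovering π (deckAction π))) := by
  refine ⟨fun G _ α h => h.isFiniteFoldRegularCovering hπ hsurj, fun hconn hlpc => ?_⟩
  have : PathConnectedSpace X := .of_locallyPathConnectedSpace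
  refine ⟨⟨fun h => ?_, ?_⟩, fun h => ?_, fun h => h.isFiniteFoldRegularCovering hπ hsurj⟩
  · have := h.finite_deckGroup
    -- Being finite, the group of covering transformations has a copy in the lowest universe.
    exact ⟨Shrink.{0} (deckGroup π), inferInstance, _,
      h.isNaturalFiniteFoldCovering hsurj (Shrink.mulEquiv.{0} (α := deckGroup π))⟩
  · rintro ⟨G, _, α, h⟩
    exact h.isFiniteFoldRegularCovering hπ hsurj
  · exact h.isNaturalFiniteFoldCovering hsurj (MulEquiv.refl _)
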